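/- **Setting.** Let $\mathfrak A=(a_{ij})$ be an $n\times n$ random matrix with i.i.d. Bernoulli($p$) entries ($\mathbb P(a_{ij}=1)=p$, $\mathbb P(a_{ij}=0)=1-p$), where $p=p_n$ may depend on $n$. For a zero-one matrix $A$ and an integer $k\ge 0$ let $\mathscr L_A(k)\subset[n]$ be the set of columns of $A$ whose support has at most $k$ elements. For a positive integer $\beta$ let $\Omega_0=\Omega_0(\beta)$ be the event $|\mathscr L_{\mathfrak A}(0)|<\beta$. For $x\in\mathbb R^n$ let $x_1^*\ge x_2^*\ge\dots\ge x_n^*$ be the non-increasing rearrangement of $|x_1|,\dots,|x_n|$, and let $\|\cdot\|$ be the Euclidean norm. For parameters $\gamma, C_{\mathcal T_1}\ge 1$ put $E=\lceil\exp(pn/\log^2(pn))\rceil$ and $R=pn/\log^3(pn)$, and let the positive integers $t_0,t_1,s$ be defined by $$3^{t_0-1}<E\le 3^{t_0},\qquad E R^{t_1-1}<\lceil 1/(\gamma p)\rceil\le E R^{t_1},\qquad s=t_0+t_1$$ (for large $n$ they exist and are unique). Let $n_0=1$, $n_j=3^j$ for $1\le j<t_0$, $n_{t_0}=E$, $n_j=\lfloor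 E R^{\,j-t_0}\rfloor$ for $t_0<j<s$, and $n_s=\lceil 1/(\gamma p)\rceil$. For $1\le j\le s$ let $$\mathcal T_{1j}=\Big\{x\in\mathbb R^n:\ x\notin\bigcup_{i=1}^{j-1}\mathcal T_{1i}\ \text{ and }\ x^*_{n_{j-1}}>C_{\mathcal T_1}\,pn\,x^*_{n_j}\Big\},\qquad \mathcal T_1=\bigcup_{j=1}^{s}\mathcal T_{1j}.$$ **Theorem.** For every positive integer $\beta$ there exist constants $C_{\mathcal T_1},\gamma,C\ge 1$, depending only on $\beta$, such that the following holds. Suppose $$\frac{\log n}{n}\le p\le\Big(1+\frac1{2\beta}\Big)\frac{\log n}{n}.$$ For every integer $k\ge C$ and all sufficiently large $n$ (depending on $\beta$ and $k$) there is an event $\Omega$, depending only on $\mathfrak A$, with $$\mathbb P(\Omega^c)\le(\log n)^{5k}\,n^{-1}=o\big(\mathbb P(\Omega_0^c)\big)$$ such that for every sample $A\in\Omega$ the following is true. Let $$\mathcal I(A)=\{i\in[n]:\ a_{ij}=1\text{ for some }j\in\mathscr L_A(k)\}.$$ Then for every $x\in\mathcal T_1$ with $\operatorname{supp}(x)\cap\mathscr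 L_A(0)=\emptyset$ at least one of the following holds: - $\|A_{\mathcal I(A),[n]}\,x\|\ge n^{-1+o(1)}\|x\|$, where $A_{\mathcal I(A),[n]}$ is the submatrix of $A$ formed by the rows in $\mathcal I(A)$; or - $\big|\{i\in[n]:\ |(Ax)_i|\ge n^{-1+o(1)}\|x\|\}\big|>k/8$. Here each $o(1)$ in an exponent is a quantity depending only on $n$ (and on $\beta,k$ and the constants) that tends to $0$ as $n\to\infty$, and all $o(\cdot)$ are uniform over the admissible $p$. -/

import Mathlib

open Filter Topology MeasureTheory

noncomputable section

namespace BernoulliRank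

/-- The sample space of `n × n` zero-one matrices; `true` stands for the entry `1`. -/
abbrev Sample (n : ℕ) : Type := Fin n × Fin n → Bool

/-- The law of an `n × n` matrix with independent Bernoulli(`p`) entries. -/
def law (n : ℕ) (p : unitInterval) : Measure (Sample n) :=
  Measure.pi fun _ => ProbabilityTheory.bernoulliMeasure true false p

instance (n : ℕ) (p : unitInterval) : IsProbabilityMeasure (law n p) := by
  unfold law; infer_instance

/-- The real zero-one matrix of a sample. -/
def toMatrix {n : ℕ} (ω : Sample n) : Matrix (Fin n) (Fin n) ℝ :=
  Matrix.of fun i j => if ω (i, j) then 1 else 0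

/-- `L_A(k)`: the columns of `A` whose support has at most `k` elements. -/
def lowColumns {n : ℕ} (A : Matrix (Fin n) (Fin n) ℝ) (k : ℕ) : Finset (Fin n) :=
  Finset.univ.filter fun j => (Finset.univ.filter fun i => A i j ≠ 0).card ≤ k

open Classical in
/-- `I(A)`: the rows that have an entry `1` in some column of `L_A(k)`. -/
def lowRows {n : ℕ} (A : Matrix (Fin n) (Fin n) ℝ) (k : ℕ) : Finset (Fin n) :=
  Finset.univ.filter fun i => ∃ j ∈ lowColumns A k, A i j = 1

/-- The event `Ω₀(β)` that the matrix has fewer than `β` zero columns. -/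
def fewZeroColumns (n β : ℕ) : Set (Sample n) :=
  {ω | (lowColumns (toMatrix ω) 0).card < β}

/-- `x*_m`, the `m`-th largest of the numbers `|x_1|, …, |x_n|`, for `1 ≤ m ≤ n`
(and `0` for `m > n`). -/
def rearr {n : ℕ} (x : EuclideanSpace ℝ (Fin n)) (m : ℕ) : ℝ :=
  if h : m - 1 < n then |x (Tuple.sort (fun i => -|x i|) ⟨m - 1, h⟩)| else 0

/-! The scales `n_0, n_1, …, n_s`. -/

/-- `⌈exp (pn / log² (pn))⌉`. -/
def baseScale (n : ℕ) (p : ℝ) : ℕ :=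
  ⌈Real.exp (p * n / Real.log (p * n) ^ 2)⌉₊

/-- `pn / log³ (pn)`. -/
def ratio (n : ℕ) (p : ℝ) : ℝ := p * n / Real.log (p * n) ^ 3

/-- `⌈1 / (γ p)⌉`. -/
def topScale (p γ : ℝ) : ℕ := ⌈1 / (γ * p)⌉₊

/-- The positive integer `t₀` with `3 ^ (t₀ - 1) < ⌈exp (pn / log² (pn))⌉ ≤ 3 ^ t₀`. -/
def t₀ (n : ℕ) (p : ℝ) : ℕ :=
  sInf {t : ℕ | 1 ≤ t ∧ 3 ^ (t - 1) < baseScale n p ∧ baseScale n p ≤ 3 ^ t}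

/-- The positive integer `t₁` with
`⌈exp (pn / log² (pn))⌉ (pn / log³ (pn)) ^ (t₁ - 1) < ⌈1 / (γ p)⌉`
`≤ ⌈exp (pn / log² (pn))⌉ (pn / log³ (pn)) ^ t₁`. -/
def t₁ (n : ℕ) (p γ : ℝ) : ℕ :=
  sInf {t : ℕ | 1 ≤ t ∧ baseScale n p * ratio n p ^ (t - 1) < topScale p γ ∧
    topScale p γ ≤ baseScale n p * ratio n p ^ t}

/-- `s = t₀ + t₁`. -/
def numScales (n : ℕ) (p γ : ℝ) : ℕ := t₀ n p + t₁ n p γ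

/-- The scales `n_j`, `0 ≤ j ≤ s`; the values that need not be integers are rounded down. -/
def scale (n : ℕ) (p γ : ℝ) (j : ℕ) : ℕ :=
  if j = 0 then 1
  else if j < t₀ n p then 3 ^ j
  else if j = t₀ n p then baseScale n p
  else if j < numScales n p γ then ⌊baseScale n p * ratio n p ^ (j - t₀ n p)⌋₊
  else topScale p γ

/-- The set `T_{1j}`, `1 ≤ j ≤ s`. -/
def steepLevel (n : ℕ) (p γ C : ℝ) (j : ℕ) : Set (EuclideanSpace ℝ (Fin n)) :=
  {x | (∀ i : Fin j, 1 ≤ (i : ℕ) → x ∉ steepLevel n p γ C i) ∧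
    C * (p * n) * rearr x (scale n p γ j) < rearr x (scale n p γ (j - 1))}
termination_by j
decreasing_by exact i.isLt

/-- `T_1`, the union of the `T_{1j}` over `1 ≤ j ≤ s`. -/
def steep (n : ℕ) (p γ C : ℝ) : Set (EuclideanSpace ℝ (Fin n)) :=
  ⋃ j ∈ Finset.Icc 1 (numScales n p γ), steepLevel n p γ C j

/-- `log n / n ≤ p ≤ (1 + 1 / (2 β)) log n / n`. -/
def InRange (β n : ℕ) (p : ℝ) : Prop :=
  Real.log n / n ≤ p ∧ p ≤ (1 + 1 / (2 * (β : ℝ))) * (Real.log n / n)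

end BernoulliRank

end

/-!
Write `u = p n`, which lies between `log n` and `2 log n`, and `E = baseScale n p`, which is
`n ^ o(1)`. Let `x` lie in `T_{1j}`, let `a` be its coordinate of rank `h = n_{j-1}`, and let `J ⊆ J'`
be the positions of its `h` and `m = n_j` largest coordinates. The coordinates outside `J'` are smaller
than `a / (C u)` with `C = 1000`, and no row has more than `5 u` ones, so these coordinates contribute at most
`a / 100` to any entry of `A x`. Hence a row whose ones in `J'` consist of a single one, at a column
where `|x|` is of order `a`, gives an entry of order `a`. Conversely `‖x‖ ≤ a n ^ (1 + o(1))`, since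
`x` avoids the earlier levels and therefore decays by at most a factor `C u` from one scale to the next
(`norm_sq_le_of_mem_steepLevel`, `eventually_norm_factor_le`). So it suffices to find either one such
row through a low column, or more than `k / 8` of them.

*Small scales*, `m ≤ E` and `m ≤ 3 h` (`large_rows_of_small_excess`). With high probability every set
of `m` columns has few ones beyond the first one in each row: the excess is at most `3 m`
(`law_exists_excess_le`). Up to a probability `(log n) ^ O(k) / n`, two low columns never share a row,
and no further column meets two low columns in distinct rows (`law_lowClash_le`). Each low column of `J`
has a row, as it is not zero. If the entry of `A x` there is small, then this row is blocked by
columns of `J'` that are not low, and the blocking columns of distinct low columns are distinct. As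
`m ≤ 3 h`, most rows are blocked by boundedly many columns, one of which then has a coordinate of
order `a`. In this way a constant proportion of `J'` consists of columns that are not low and have
coordinates of order `a`. Each of them has more than `k` ones, so for large `k` the bound on the excess
leaves many rows that meet `J'` in such a column only.

*Large scales*, `E ≤ h` and `m ≤ 2 (u / log ^ 3 u) h`. A union bound over the pairs `J ⊆ J'` alone is
too costly. First, a union bound over `J` gives many rows that meet `J` once
(`law_few_singleRows_le`); given these rows, the columns of `J' \ J` are unlikely to meet almost all of
them, with a probability so small that it pays for the choice of `J'` (`law_blocked_le`,
`exists_union_params`).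

All probabilities are exponential moments of products over independent entries, rows or columns,
computed as finite sums by `mean`. The comparison with the event of at least `β` zero columns is a
lower bound for the probability of exactly `β` zero columns (`le_law_compl_fewZeroColumns`).
-/

namespace BernoulliRank

/-! ### Independent Bernoulli variables -/

/-- The probability that a Bernoulli(`p`) variable takes the value `b`. -/
def bernWeight (p : ℝ) (b : Bool) : ℝ := if b then p else 1 - p

/-- The expectation of `f` for a family of independent Bernoulli(`p`) variables, as a finite sum. -/
def mean {ι : Type*} [Fintype ι] [DecidableEq ι] (p : ℝ) (f : (ι → Bool) → ℝ) : ℝ :=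
  ∑ r, (∏ i, bernWeight p (r i)) * f r

section Mean

variable {ι κ : Type*} [Fintype ι] [DecidableEq ι] [Fintype κ] [DecidableEq κ] {p : ℝ}

lemma bernWeight_nonneg (h0 : 0 ≤ p) (h1 : p ≤ 1) (b : Bool) : 0 ≤ bernWeight p b := by
  unfold bernWeight; split_ifs <;> linarith

/-- The entries are independent. -/
lemma mean_prod (g : ι → Bool → ℝ) :
    mean p (fun r => ∏ i, g i (r i)) = ∏ i, (p * g i true + (1 - p) * g i false) := by
  have := Finset.prod_univ_sum (fun _ : ι => (Finset.univ : Finset Bool))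
    (fun i b => bernWeight p b * g i b)
  simp only [Fintype.piFinset_univ, Fintype.sum_bool] at this
  simp only [mean, ← Finset.prod_mul_distrib]
  rw [← this]
  simp [bernWeight]

lemma mean_one : mean (ι := ι) p (fun _ => 1) = 1 := by
  simpa using mean_prod (ι := ι) (p := p) (fun _ _ => 1)

lemma mean_add (f g : (ι → Bool) → ℝ) :
    mean p (fun r => f r + g r) = mean p f + mean p g := by
  simp [mean, mul_add, Finset.sum_add_distrib]

lemma mean_const_mul (c : ℝ) (f : (ι → Bool) → ℝ) :
    mean p (fun r => c * f r) = c * mean p f := by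
  simp only [mean, Finset.mul_sum]
  exact Finset.sum_congr rfl fun _ _ => by ring

lemma mean_sum {α : Type*} (s : Finset α) (f : α → (ι → Bool) → ℝ) :
    mean p (fun r => ∑ a ∈ s, f a r) = ∑ a ∈ s, mean p (f a) := by
  simp only [mean, Finset.mul_sum]
  exact Finset.sum_comm

lemma mean_mono (h0 : 0 ≤ p) (h1 : p ≤ 1) {f g : (ι → Bool) → ℝ} (h : ∀ r, f r ≤ g r) :
    mean p f ≤ mean p g :=
  Finset.sum_le_sum fun r _ => mul_le_mul_of_nonneg_left (h r)
    (Finset.prod_nonneg fun _ _ => bernWeight_nonneg h0 h1 _)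

lemma mean_nonneg (h0 : 0 ≤ p) (h1 : p ≤ 1) {f : (ι → Bool) → ℝ} (h : ∀ r, 0 ≤ f r) :
    0 ≤ mean p f :=
  Finset.sum_nonneg fun r _ => mul_nonneg
    (Finset.prod_nonneg fun _ _ => bernWeight_nonneg h0 h1 _) (h r)

/-- The rows of a random matrix are independent. -/
lemma mean_prod_rows (f : ι → (κ → Bool) → ℝ) :
    mean p (fun ω : ι × κ → Bool => ∏ i, f i (fun j => ω (i, j))) = ∏ i, mean p (f i) := by
  have := Finset.prod_univ_sum (fun _ : ι => (Finset.univ : Finset (κ → Bool)))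
    (fun i r => (∏ j, bernWeight p (r j)) * f i r)
  simp only [Fintype.piFinset_univ] at this
  simp only [mean]
  rw [this, ← Equiv.sum_comp (Equiv.curry ι κ Bool)]
  refine Finset.sum_congr rfl fun ω _ => ?_
  rw [Fintype.prod_prod_type, ← Finset.prod_mul_distrib]
  rfl

/-- The columns of a random matrix are independent. -/
lemma mean_prod_cols (f : κ → (ι → Bool) → ℝ) :
    mean p (fun ω : ι × κ → Bool => ∏ j, f j (fun i => ω (i, j))) = ∏ j, mean p (f j) := by
  rw [← mean_prod_rows]
  simp only [mean]
  rw [← Equiv.sum_comp ((Equiv.prodComm ι κ).arrowCongr (Equiv.refl Bool))]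
  refine Finset.sum_congr rfl fun ω _ => ?_
  rw [← Equiv.prod_comp (Equiv.prodComm ι κ)]
  simp [Equiv.arrowCongr]

end Mean

lemma law_singleton (n : ℕ) (p : unitInterval) (ω : Sample n) :
    (law n p).real {ω} = ∏ e, bernWeight p (ω e) := by
  rw [law, measureReal_def, Measure.pi_singleton, ENNReal.toReal_prod]
  refine Finset.prod_congr rfl fun e _ => ?_
  have := ProbabilityTheory.bernoulliMeasure_real_apply (x := true) (y := false) p
    (s := {ω e}) (MeasurableSet.singleton _)
  rw [measureReal_def] at this
  rw [this]
  cases h : ω e <;> simp [bernWeight]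

open Classical in
lemma law_real_eq_mean {n : ℕ} (p : unitInterval) (S : Set (Sample n)) :
    (law n p).real S = mean (p : ℝ) (fun ω => if ω ∈ S then 1 else 0) := by
  have hS : S = ((Finset.univ.filter (· ∈ S) : Finset (Sample n)) : Set (Sample n)) := by
    ext; simp
  conv_lhs => rw [hS]
  rw [← sum_measureReal_singleton]
  simp only [law_singleton, mean, mul_ite, mul_one, mul_zero]
  rw [Finset.sum_filter]

/-- Markov's inequality in the form used for all exponential moment bounds. -/
lemma law_real_le_mean {n : ℕ} {p : unitInterval} {S : Set (Sample n)} {f : Sample n → ℝ}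
    (h0 : ∀ ω, 0 ≤ f ω) (h1 : ∀ ω ∈ S, 1 ≤ f ω) : (law n p).real S ≤ mean (p : ℝ) f := by
  classical
  rw [law_real_eq_mean]
  refine mean_mono p.2.1 p.2.2 fun ω => ?_
  split_ifs with h
  exacts [h1 ω h, h0 ω]

/-! ### Counting ones in rows, and the excess of a set of columns -/

/-- The number of elements of `S` at which `r` is `true`. -/
def hits {ι : Type*} (r : ι → Bool) (S : Finset ι) : ℕ := (S.filter fun j => r j = true).card

/-- The `i`-th row of a sample. -/
def row {n : ℕ} (ω : Sample n) (i : Fin n) : Fin n → Bool := fun j => ω (i, j)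

/-- The `j`-th column of a sample. -/
def col {n : ℕ} (ω : Sample n) (j : Fin n) : Fin n → Bool := fun i => ω (i, j)

section Hits

variable {ι : Type*} [Fintype ι] [DecidableEq ι] {p : ℝ}

lemma pow_hits (c : ℝ) (r : ι → Bool) (S : Finset ι) :
    c ^ hits r S = ∏ j, if j ∈ S then (if r j = true then c else 1) else 1 := by
  rw [Finset.prod_ite_mem, Finset.univ_inter, Finset.prod_ite, Finset.prod_const_one, mul_one,
    Finset.prod_const, hits]

lemma mean_pow_hits (c : ℝ) (S : Finset ι) :
    mean p (fun r => c ^ hits r S) = (1 - p + p * c) ^ S.card := by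
  simp only [pow_hits]
  rw [mean_prod (fun j b => if j ∈ S then (if b = true then c else 1) else 1)]
  have : ∀ j : ι, (p * (if j ∈ S then (if true = true then c else 1) else 1) +
      (1 - p) * (if j ∈ S then (if false = true then c else 1) else 1)) =
      if j ∈ S then (1 - p + p * c) else 1 := by
    intro j; split_ifs <;> simp_all; ring
  rw [Finset.prod_congr rfl fun j _ => this j, Finset.prod_ite_mem, Finset.univ_inter,
    Finset.prod_const]

open Classical in
/-- The event of exactly one hit in `J` and none in `K`, as a sum over the position of the hit of
products of functions of single entries. -/
lemma indicator_single_hit (r : ι → Bool) {J K : Finset ι} (hd : Disjoint J K) :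
    (if hits r J = 1 ∧ hits r K = 0 then (1 : ℝ) else 0) =
      ∑ u ∈ J, ∏ j, (if j ∈ J ∪ K then (if (r j = true ↔ j = u) then (1 : ℝ) else 0) else 1) := by
  have h1 : ∀ u, (∏ j, (if j ∈ J ∪ K then (if (r j = true ↔ j = u) then (1 : ℝ) else 0) else 1)) =
      if (∀ j ∈ J ∪ K, (r j = true ↔ j = u)) then 1 else 0 := by
    intro u
    rw [Finset.prod_ite_mem, Finset.univ_inter, Finset.prod_ite_zero]
    simp
  simp only [h1]
  have hK : ∀ u ∈ J, (∀ j ∈ K, ¬ r j = true) → (∀ j ∈ K, (r j = true ↔ j = u)) := by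
    intro u hu h j hj
    constructor
    · exact fun h' => absurd h' (h j hj)
    · rintro rfl
      exact absurd hj (Finset.disjoint_left.1 hd hu)
  split_ifs with h
  · obtain ⟨hJ, hK0⟩ := h
    obtain ⟨u, hu⟩ := Finset.card_eq_one.1 hJ
    have hmem : ∀ j, (j ∈ J ∧ r j = true) ↔ j = u := by
      intro j
      have := Finset.ext_iff.1 hu j
      simpa using this
    have huJ := ((hmem u).2 rfl).1
    have hK' : ∀ j ∈ K, ¬ r j = true := by
      simpa [hits, Finset.filter_eq_empty_iff] using hK0
    rw [Finset.sum_eq_single_of_mem u huJ]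
    · rw [if_pos]
      intro j hj
      rcases Finset.mem_union.1 hj with hj | hj
      · exact ⟨fun h => (hmem j).1 ⟨hj, h⟩, fun h => ((hmem j).2 h).2⟩
      · exact hK u huJ hK' j hj
    · intro v _ hv
      rw [if_neg]
      intro h
      exact hv (((h u (Finset.mem_union_left _ huJ)).1 ((hmem u).2 rfl).2).symm)
  · symm
    refine Finset.sum_eq_zero fun u hu => if_neg fun hall => h ⟨?_, ?_⟩
    · refine Finset.card_eq_one.2 ⟨u, ?_⟩
      ext j
      simp only [Finset.mem_filter, Finset.mem_singleton]
      refine ⟨fun hj => (hall j (Finset.mem_union_left _ hj.1)).1 hj.2, ?_⟩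
      rintro rfl
      exact ⟨hu, (hall j (Finset.mem_union_left _ hu)).2 rfl⟩
    · refine Finset.card_eq_zero.2 (Finset.filter_eq_empty_iff.2 fun j hj hr => ?_)
      have := (hall j (Finset.mem_union_right _ hj)).1 hr
      exact Finset.disjoint_left.1 hd hu (this ▸ hj)

lemma mean_single_hit {J K : Finset ι} (hd : Disjoint J K) :
    mean p (fun r => if hits r J = 1 ∧ hits r K = 0 then (1 : ℝ) else 0) =
      J.card * (p * (1 - p) ^ (J.card - 1 + K.card)) := by
  classical
  simp only [indicator_single_hit _ hd]
  rw [mean_sum]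
  rw [Finset.sum_congr rfl (g := fun _ => p * (1 - p) ^ (J.card - 1 + K.card))]
  · simp
  intro u hu
  rw [mean_prod (fun j b => if j ∈ J ∪ K then (if (b = true ↔ j = u) then (1 : ℝ) else 0) else 1)]
  have h1 : ∀ j : ι, (p * (if j ∈ J ∪ K then (if (true = true ↔ j = u) then (1 : ℝ) else 0) else 1) +
      (1 - p) * (if j ∈ J ∪ K then (if (false = true ↔ j = u) then (1 : ℝ) else 0) else 1)) =
      if j ∈ J ∪ K then (if j = u then p else 1 - p) else 1 := by
    intro j
    by_cases hj' : j ∈ J ∪ K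
    · simp only [if_pos hj']
      by_cases hj : j = u <;> simp [hj]
    · simp only [if_neg hj']
      ring
  rw [Finset.prod_congr rfl fun j _ => h1 j]
  have huJK : u ∈ J ∪ K := Finset.mem_union_left _ hu
  rw [Finset.prod_ite_mem, Finset.univ_inter, ← Finset.mul_prod_erase _ _ huJK, if_pos rfl]
  congr 1
  rw [Finset.prod_congr rfl (g := fun _ => 1 - p) fun j hj => if_neg (Finset.ne_of_mem_erase hj),
    Finset.prod_const, Finset.card_erase_of_mem huJK, Finset.card_union_of_disjoint hd]
  congr 1
  have := Finset.card_pos.2 ⟨u, hu⟩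
  omega

end Hits

lemma mean_row {n : ℕ} {p : ℝ} (i : Fin n) (g : (Fin n → Bool) → ℝ) :
    mean p (fun ω : Sample n => g (row ω i)) = mean p g := by
  have := mean_prod_rows (p := p) (fun i' : Fin n => if i' = i then g else fun _ : Fin n → Bool => 1)
  have h2 : ∀ ω : Sample n, (∏ i', (if i' = i then g else fun _ : Fin n → Bool => 1)
      (fun j => ω (i', j))) = g (row ω i) := by
    intro ω
    rw [Finset.prod_eq_single_of_mem i (Finset.mem_univ _)]
    · simp only [if_true]; rfl
    · intro b _ hb; simp [hb]
  simp only [h2] at this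
  rw [this, Finset.prod_eq_single_of_mem i (Finset.mem_univ _)]
  · simp
  · intro b _ hb; simp [hb, mean_one]

lemma mean_prod_row {n : ℕ} {p : ℝ} (g : (Fin n → Bool) → ℝ) :
    mean p (fun ω : Sample n => ∏ i, g (row ω i)) = mean p g ^ n := by
  have := mean_prod_rows (p := p) (fun _ : Fin n => g)
  rwa [Finset.prod_const, Finset.card_univ, Fintype.card_fin] at this

/-- The union bound, with a uniform bound for the single events. -/
lemma law_union_le {n : ℕ} {p : unitInterval} {α : Type*} (s : Finset α) (S : α → Set (Sample n))
    (T : Set (Sample n)) {c : ℝ} (hT : ∀ ω ∈ T, ∃ a ∈ s, ω ∈ S a)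
    (hS : ∀ a ∈ s, (law n p).real (S a) ≤ c) : (law n p).real T ≤ s.card * c := by
  calc (law n p).real T ≤ (law n p).real (⋃ a ∈ s, S a) := by
        refine measureReal_mono (fun ω hω => ?_) (measure_ne_top _ _)
        obtain ⟨a, ha, h⟩ := hT ω hω
        exact Set.mem_biUnion (s := (s : Set α)) ha h
    _ ≤ ∑ a ∈ s, (law n p).real (S a) := measureReal_biUnion_finset_le s S
    _ ≤ s.card * c := by
        rw [← nsmul_eq_mul]
        exact Finset.sum_le_card_nsmul _ _ _ hS

/-- Chernoff bound: no row has more than `5 p n` ones. -/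
lemma law_long_row_le (n : ℕ) (p : unitInterval) :
    (law n p).real {ω | ∃ i, 5 * ((p : ℝ) * n) < hits (row ω i) Finset.univ} ≤
      n * Real.exp (-3 * ((p : ℝ) * n)) := by
  have := law_union_le (p := p) (Finset.univ : Finset (Fin n))
    (fun i => {ω | 5 * ((p : ℝ) * n) < hits (row ω i) Finset.univ})
    {ω | ∃ i, 5 * ((p : ℝ) * n) < hits (row ω i) Finset.univ}
    (c := Real.exp (-3 * ((p : ℝ) * n))) (by simp) ?_
  · simpa using this
  intro i _
  refine (law_real_le_mean (f := fun ω => Real.exp (-(5 * ((p : ℝ) * n))) *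
    Real.exp 1 ^ hits (row ω i) Finset.univ) (fun ω => by positivity) ?_).trans ?_
  · intro ω hω
    rw [← Real.exp_nat_mul, ← Real.exp_add]
    refine Real.one_le_exp ?_
    have : 5 * ((p : ℝ) * n) < hits (row ω i) Finset.univ := hω
    linarith
  · rw [mean_const_mul, mean_row i (fun r => Real.exp 1 ^ hits r Finset.univ), mean_pow_hits,
      Finset.card_univ, Fintype.card_fin]
    have h1 : (1 - (p : ℝ) + p * Real.exp 1) ^ n ≤ Real.exp (2 * (p * n)) := by
      have h2 : 1 - (p : ℝ) + p * Real.exp 1 ≤ Real.exp (2 * p) := by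
        have := Real.add_one_le_exp (2 * (p : ℝ))
        have he := Real.exp_one_lt_d9
        nlinarith [p.2.1]
      calc _ ≤ Real.exp (2 * p) ^ n := by
            refine pow_le_pow_left₀ ?_ h2 n
            have := p.2.1; have := p.2.2; have := Real.exp_pos 1
            nlinarith [mul_nonneg p.2.1 this.le]
        _ = _ := by rw [← Real.exp_nat_mul]; ring_nf
    calc _ ≤ Real.exp (-(5 * ((p : ℝ) * n))) * Real.exp (2 * (p * n)) := by gcongr
      _ = _ := by rw [← Real.exp_add]; ring_nf

/-- The number of ones in excess of the first one in each row, restricted to the columns `S`. -/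
def excess {n : ℕ} (ω : Sample n) (S : Finset (Fin n)) : ℕ := ∑ i, (hits (row ω i) S - 1)

/-- The exponential moment of the excess of a single row; it follows from
`c ^ (h - 1) = c⁻¹ * c ^ h + (1 - c⁻¹) * 0 ^ h` in truncated subtraction. -/
lemma mean_pow_excess_row_le {ι : Type*} [Fintype ι] [DecidableEq ι] {p c : ℝ} (S : Finset ι)
    (h0 : 0 ≤ p) (h1 : p ≤ 1) (hc : 1 ≤ c) (hS : S.card * p * c ≤ 1) :
    mean p (fun r => c ^ (hits r S - 1)) ≤ 1 + (S.card * p) ^ 2 * (1 + c) := by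
  have hc0 : 0 < c := by linarith
  have hpt : ∀ r : ι → Bool, c ^ (hits r S - 1) =
      c⁻¹ * c ^ hits r S + (1 - c⁻¹) * 0 ^ hits r S := by
    intro r
    rcases Nat.eq_zero_or_pos (hits r S) with h | h
    · simp [h]
    · obtain ⟨t, ht⟩ := Nat.exists_eq_add_of_le' h
      simp [ht, pow_succ]; field_simp
  simp only [hpt]
  rw [mean_add, mean_const_mul, mean_const_mul, mean_pow_hits, mean_pow_hits]
  set m : ℝ := (S.card : ℝ) with hm
  have hm0 : 0 ≤ m := by positivity
  have hmp : 0 ≤ m * p := by positivity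
  have hmp1 : m * p ≤ 1 := by nlinarith
  have e1 : (1 - p + p * c) ^ S.card ≤ 1 + m * (p * (c - 1)) + (m * (p * (c - 1))) ^ 2 := by
    have hx : 0 ≤ m * (p * (c - 1)) := by
      have : 0 ≤ c - 1 := by linarith
      positivity
    have hx1 : m * (p * (c - 1)) ≤ 1 := by nlinarith
    calc (1 - p + p * c) ^ S.card ≤ Real.exp (p * (c - 1)) ^ S.card := by
          refine pow_le_pow_left₀ (by nlinarith) ?_ _
          have := Real.add_one_le_exp (p * (c - 1)); linarith
      _ = Real.exp (m * (p * (c - 1))) := by rw [← Real.exp_nat_mul]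
      _ ≤ _ := by
          have := Real.abs_exp_sub_one_sub_id_le (x := m * (p * (c - 1)))
            (by rw [abs_of_nonneg hx]; exact hx1)
          have := (abs_le.1 this).2
          linarith
  have e2 : (1 - p + p * 0) ^ S.card ≤ 1 - m * p + (m * p) ^ 2 := by
    calc (1 - p + p * 0) ^ S.card ≤ Real.exp (-p) ^ S.card := by
          refine pow_le_pow_left₀ (by linarith) ?_ _
          have := Real.add_one_le_exp (-p); linarith
      _ = Real.exp (-(m * p)) := by rw [← Real.exp_nat_mul, mul_neg]
      _ ≤ _ := by
          have := Real.abs_exp_sub_one_sub_id_le (x := -(m * p))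
            (by rw [abs_neg, abs_of_nonneg hmp]; exact hmp1)
          have := (abs_le.1 this).2
          linarith
  have hci : 0 ≤ c⁻¹ := by positivity
  have hci1 : c⁻¹ ≤ 1 := inv_le_one_of_one_le₀ hc
  calc _ ≤ c⁻¹ * (1 + m * (p * (c - 1)) + (m * (p * (c - 1))) ^ 2) +
        (1 - c⁻¹) * (1 - m * p + (m * p) ^ 2) := by
        gcongr
    _ = 1 + (m * p) ^ 2 * ((c - 1) ^ 2 * c⁻¹ + (1 - c⁻¹)) := by field_simp; ring
    _ ≤ _ := by
        have h3 : (c - 1) ^ 2 * c⁻¹ + (1 - c⁻¹) ≤ 1 + c := by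
          have : (c - 1) ^ 2 * c⁻¹ = c - 2 + c⁻¹ := by field_simp; ring
          rw [this]; linarith
        gcongr

lemma law_excess_le {n : ℕ} (p : unitInterval) (S : Finset (Fin n)) {c : ℝ} (hc : 1 ≤ c)
    (hS : S.card * (p : ℝ) * c ≤ 1) :
    (law n p).real {ω | 3 * S.card < excess ω S} ≤
      c⁻¹ ^ (3 * S.card) * Real.exp (n * ((S.card * p) ^ 2 * (1 + c))) := by
  have hc0 : 0 < c := by linarith
  refine (law_real_le_mean (f := fun ω => c⁻¹ ^ (3 * S.card) *
    ∏ i, c ^ (hits (row ω i) S - 1)) (fun ω => by positivity) ?_).trans ?_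
  · intro ω hω
    have : 3 * S.card < excess ω S := hω
    rw [Finset.prod_pow_eq_pow_sum, inv_pow, inv_mul_eq_div, one_le_div (by positivity)]
    exact pow_le_pow_right₀ hc this.le
  · rw [mean_const_mul, mean_prod_row (fun r => c ^ (hits r S - 1))]
    gcongr
    rw [Real.exp_nat_mul]
    refine pow_le_pow_left₀ (mean_nonneg p.2.1 p.2.2 fun r => by positivity) ?_ n
    refine (mean_pow_excess_row_le S p.2.1 p.2.2 hc hS).trans ?_
    have := Real.add_one_le_exp ((S.card * (p : ℝ)) ^ 2 * (1 + c))
    linarith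

/-! ### Rows that meet a set of columns once -/

/-- The rows with exactly one `1` in the columns `J` and none in the columns `K`. -/
def singleRows {n : ℕ} (ω : Sample n) (J K : Finset (Fin n)) : Finset (Fin n) :=
  Finset.univ.filter fun i => hits (row ω i) J = 1 ∧ hits (row ω i) K = 0

lemma prod_singleRows {n : ℕ} (ω : Sample n) (J K : Finset (Fin n)) (c : ℝ) :
    ∏ i, (if hits (row ω i) J = 1 ∧ hits (row ω i) K = 0 then c else 1) =
      c ^ (singleRows ω J K).card := by
  rw [Finset.prod_ite, Finset.prod_const_one, mul_one, Finset.prod_const, singleRows]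

/-- Lower tail for the number of rows that meet the columns `J` exactly once. -/
lemma law_few_singleRows_le {n : ℕ} (p : unitInterval) (J : Finset (Fin n)) {θ T : ℝ}
    (hθ : 0 ≤ θ) :
    (law n p).real {ω | ((singleRows ω J ∅).card : ℝ) ≤ T} ≤
      Real.exp (θ * T - J.card * (p * n) * (1 - J.card * p) * (1 - Real.exp (-θ))) := by
  refine (law_real_le_mean (f := fun ω => Real.exp (θ * T) *
    ∏ i, (if hits (row ω i) J = 1 ∧ hits (row ω i) ∅ = 0 then Real.exp (-θ) else 1))
    (fun ω => ?_) ?_).trans ?_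
  · exact mul_nonneg (Real.exp_pos _).le (Finset.prod_nonneg fun i _ => by split_ifs <;> positivity)
  · intro ω hω
    have hω' : ((singleRows ω J ∅).card : ℝ) ≤ T := hω
    rw [prod_singleRows, ← Real.exp_nat_mul, ← Real.exp_add]
    refine Real.one_le_exp ?_
    nlinarith
  · rw [mean_const_mul,
      mean_prod_row (fun r => if hits r J = 1 ∧ hits r ∅ = 0 then Real.exp (-θ) else 1)]
    have h1 : ∀ r : Fin n → Bool, (if hits r J = 1 ∧ hits r ∅ = 0 then Real.exp (-θ) else 1) =
        1 + (-(1 - Real.exp (-θ))) * (if hits r J = 1 ∧ hits r ∅ = 0 then 1 else 0) := by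
      intro r; split_ifs <;> ring
    simp only [h1]
    rw [mean_add, mean_one, mean_const_mul, mean_single_hit (Finset.disjoint_empty_right J),
      Finset.card_empty, add_zero, sub_eq_add_neg (θ * T), Real.exp_add]
    have he : 0 ≤ 1 - Real.exp (-θ) := by
      have : Real.exp (-θ) ≤ 1 := Real.exp_le_one_iff.2 (by linarith)
      linarith
    gcongr
    have hp0 := p.2.1
    have hp1 := p.2.2
    have hb : (J.card : ℝ) * (p * (1 - J.card * p)) ≤ J.card * (p * (1 - (p : ℝ)) ^ (J.card - 1)) := by
      gcongr
      have h2 := one_add_mul_le_pow (a := -(p : ℝ)) (by linarith) (J.card - 1)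
      have h3 : ((J.card - 1 : ℕ) : ℝ) ≤ J.card := by exact_mod_cast Nat.sub_le _ _
      rw [← sub_eq_add_neg] at h2
      nlinarith
    have h4 : (J.card : ℝ) * ((p : ℝ) * n) * (1 - J.card * (p : ℝ)) * (1 - Real.exp (-θ)) =
        n * ((J.card : ℝ) * (p * (1 - J.card * p)) * (1 - Real.exp (-θ))) := by ring
    rw [h4, ← mul_neg, Real.exp_nat_mul]
    refine pow_le_pow_left₀ ?_ ?_ n
    · have h5 : (0 : ℝ) ≤ mean (p : ℝ) (fun r : Fin n → Bool =>
          if hits r J = 1 ∧ hits r ∅ = 0 then Real.exp (-θ) else 1) :=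
        mean_nonneg hp0 hp1 fun r => by split_ifs <;> positivity
      simp only [h1] at h5
      rw [mean_add, mean_one, mean_const_mul, mean_single_hit (Finset.disjoint_empty_right J),
        Finset.card_empty, add_zero] at h5
      exact h5
    · refine le_trans ?_ (Real.add_one_le_exp _)
      nlinarith [mul_le_mul_of_nonneg_right hb he]

/-- If many rows meet `J` exactly once, then it is unlikely that the columns `K` hit almost all of
these rows. The weights on the two kinds of rows are chosen so that the mean of each row factor
is at most `1`. -/
lemma law_blocked_le {n : ℕ} (p : unitInterval) {J K : Finset (Fin n)} (hd : Disjoint J K)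
    {κ T y : ℝ} (hy : Real.log 2 ≤ y) (hK : K.card * (p : ℝ) ≤ Real.exp (-y)) :
    (law n p).real {ω | T ≤ (singleRows ω J ∅).card ∧ ((singleRows ω J K).card : ℝ) ≤ κ} ≤
      Real.exp (κ * y + T * (Real.log 2 - y)) := by
  have hp0 := p.2.1
  have hp1 := p.2.2
  have hy0 : 0 ≤ y := (Real.log_nonneg (by norm_num)).trans hy
  set μ := Real.exp (y - Real.log 2) with hμ
  set l := Real.exp (-y) with hl
  have hl1 : l ≤ 1 := Real.exp_le_one_iff.2 (by linarith)
  have hl0 : 0 < l := Real.exp_pos _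
  have hμl : μ * l * 2 = 1 := by
    rw [hμ, hl, ← Real.exp_add]
    have : y - Real.log 2 + -y = - Real.log 2 := by ring
    rw [this, Real.exp_neg, Real.exp_log (by norm_num)]
    norm_num
  have hμ0 : 0 < μ := Real.exp_pos _
  set g : (Fin n → Bool) → ℝ := fun r => (if hits r J = 1 ∧ hits r ∅ = 0 then μ else 1) *
    (if hits r J = 1 ∧ hits r K = 0 then l else 1) with hg
  have hgnn : ∀ r, 0 ≤ g r := fun r => by
    simp only [hg]; split_ifs <;> positivity
  refine (law_real_le_mean (f := fun ω => Real.exp (κ * y + T * (Real.log 2 - y)) *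
    ∏ i, g (row ω i)) (fun ω => ?_) ?_).trans ?_
  · exact mul_nonneg (Real.exp_pos _).le (Finset.prod_nonneg fun i _ => hgnn _)
  · rintro ω ⟨h1, h2⟩
    simp only [hg]
    rw [Finset.prod_mul_distrib, prod_singleRows, prod_singleRows, hμ, hl, ← Real.exp_nat_mul,
      ← Real.exp_nat_mul, ← Real.exp_add, ← Real.exp_add]
    refine Real.one_le_exp ?_
    nlinarith
  · rw [mean_const_mul, mean_prod_row]
    refine mul_le_of_le_one_right (Real.exp_pos _).le (pow_le_one₀ (mean_nonneg hp0 hp1 hgnn) ?_)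
    have h1 : ∀ r : Fin n → Bool, g r =
        (1 + (μ - 1) * (if hits r J = 1 ∧ hits r ∅ = 0 then 1 else 0)) +
          (μ * l - μ) * (if hits r J = 1 ∧ hits r K = 0 then 1 else 0) := by
      intro r
      have he : hits r ∅ = 0 := by simp [hits]
      by_cases ha : hits r J = 1 <;> by_cases hb : hits r K = 0 <;> simp [hg, he, ha, hb]
    rw [funext h1, mean_add, mean_add, mean_one, mean_const_mul, mean_const_mul,
      mean_single_hit (Finset.disjoint_empty_right J), mean_single_hit hd,
      Finset.card_empty, add_zero, pow_add]
    set b : ℝ := (J.card : ℝ) * (p * (1 - p) ^ (J.card - 1)) with hb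
    have hb0 : 0 ≤ b := by
      have : 0 ≤ 1 - (p : ℝ) := by linarith
      positivity
    have h2 : 1 - l ≤ (1 - (p : ℝ)) ^ K.card := by
      have h2 := one_add_mul_le_pow (a := -(p : ℝ)) (by linarith) K.card
      rw [← sub_eq_add_neg] at h2
      linarith
    have h3 : (J.card : ℝ) * (p * ((1 - p) ^ (J.card - 1) * (1 - p) ^ K.card)) =
      b * (1 - p) ^ K.card := by rw [hb]; ring
    rw [h3]
    have h4 : μ * (1 - l) * (1 - l) ≤ μ * (1 - l) * (1 - (p : ℝ)) ^ K.card := by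
      have : 0 ≤ 1 - l := by linarith
      gcongr
    have h5 : (μ - 1) - μ * (1 - l) * (1 - (p : ℝ)) ^ K.card ≤ 0 := by nlinarith [mul_pos hμ0 hl0]
    nlinarith

lemma choose_le_exp {n h : ℕ} (hn : 0 < n) (hh : 0 < h) :
    (n.choose h : ℝ) ≤ Real.exp (h * (1 + Real.log n - Real.log h)) := by
  have hh' : (0 : ℝ) < h := by exact_mod_cast hh
  have hn' : (0 : ℝ) < n := by exact_mod_cast hn
  have h1 : (n.choose h : ℝ) ≤ (n : ℝ) ^ h / h.factorial := Nat.choose_le_pow_div h n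
  have h2 : (h : ℝ) ^ h / h.factorial ≤ Real.exp h := Real.pow_div_factorial_le_exp _ hh'.le h
  have hf : (0 : ℝ) < h.factorial := by exact_mod_cast Nat.factorial_pos h
  have h3 : Real.exp (h * (1 + Real.log n - Real.log h)) = Real.exp h * ((n : ℝ) ^ h / (h : ℝ) ^ h) := by
    rw [mul_sub, mul_add, mul_one, Real.exp_sub, Real.exp_add, Real.exp_nat_mul (Real.log n),
      Real.exp_nat_mul (Real.log h), Real.exp_log hn', Real.exp_log hh', mul_div_assoc]
  rw [h3]
  calc (n.choose h : ℝ) ≤ (n : ℝ) ^ h / h.factorial := h1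
    _ = (h : ℝ) ^ h / h.factorial * ((n : ℝ) ^ h / (h : ℝ) ^ h) := by field_simp
    _ ≤ _ := by gcongr

/-- The union bound over all pairs `J ⊆ J'` of column sets of sizes `h` and `m`: first over `J`
alone, for the rows that meet `J` once, and then over the pair. -/
lemma law_exists_blocked_le {n : ℕ} (p : unitInterval) {h m : ℕ} (hh : 0 < h) (hm : 0 < m)
    (hn : 0 < n) {κ T y θ : ℝ} (hθ : 0 ≤ θ) (hy : Real.log 2 ≤ y)
    (hmp : m * (p : ℝ) ≤ Real.exp (-y)) :
    (law n p).real {ω | ∃ J J' : Finset (Fin n), J ⊆ J' ∧ J.card = h ∧ J'.card = m ∧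
        ((singleRows ω J (J' \ J)).card : ℝ) ≤ κ} ≤
      Real.exp (h * (1 + Real.log n - Real.log h) + θ * T -
          h * (p * n) * (1 - h * p) * (1 - Real.exp (-θ))) +
        Real.exp (m * (1 + Real.log n - Real.log m + Real.log 2) + κ * y +
          T * (Real.log 2 - y)) := by
  set A : Set (Sample n) := {ω | ∃ J : Finset (Fin n), J.card = h ∧
    ((singleRows ω J ∅).card : ℝ) ≤ T}
  set B : Set (Sample n) := {ω | ∃ J J' : Finset (Fin n), J ⊆ J' ∧ J.card = h ∧ J'.card = m ∧
    T ≤ (singleRows ω J ∅).card ∧ ((singleRows ω J (J' \ J)).card : ℝ) ≤ κ}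
  have hA : (law n p).real A ≤ n.choose h * Real.exp (θ * T -
      h * (p * n) * (1 - h * p) * (1 - Real.exp (-θ))) := by
    have := law_union_le (p := p) (Finset.univ.powersetCard h : Finset (Finset (Fin n)))
      (fun J => {ω | ((singleRows ω J ∅).card : ℝ) ≤ T}) A
      (c := Real.exp (θ * T - h * (p * n) * (1 - h * p) * (1 - Real.exp (-θ)))) ?_ ?_
    · simpa using this
    · rintro ω ⟨J, hJ, hω⟩
      exact ⟨J, by simp [hJ], hω⟩
    · intro J hJ
      have : J.card = h := (Finset.mem_powersetCard.1 hJ).2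
      subst this
      exact law_few_singleRows_le p J hθ
  have hB : (law n p).real B ≤ (n.choose m * 2 ^ m : ℕ) * Real.exp (κ * y +
      T * (Real.log 2 - y)) := by
    have hcard : ((Finset.univ.powersetCard m : Finset (Finset (Fin n))).sigma
        fun J' => J'.powerset).card = n.choose m * 2 ^ m := by
      rw [Finset.card_sigma, Finset.sum_congr rfl (g := fun _ => 2 ^ m)]
      · simp
      · intro J' hJ'
        rw [Finset.card_powerset, (Finset.mem_powersetCard.1 hJ').2]
    rw [← hcard]
    refine law_union_le (p := p) _ (fun q : (_ : Finset (Fin n)) × Finset (Fin n) =>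
      {ω | T ≤ (singleRows ω q.2 ∅).card ∧ ((singleRows ω q.2 (q.1 \ q.2)).card : ℝ) ≤ κ}) B ?_ ?_
    · rintro ω ⟨J, J', hJJ, hJ, hJ', hω⟩
      exact ⟨⟨J', J⟩, by simp [hJ', hJJ], hω⟩
    · rintro ⟨J', J⟩ hq
      refine law_blocked_le p Finset.disjoint_sdiff hy (le_trans ?_ hmp)
      have hJ' : J'.card = m := by simpa using (Finset.mem_sigma.1 hq).1
      have : (J' \ J).card ≤ m := hJ' ▸ Finset.card_le_card Finset.sdiff_subset
      have hp0 := p.2.1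
      have h2 : ((J' \ J).card : ℝ) ≤ m := by exact_mod_cast this
      exact mul_le_mul_of_nonneg_right h2 hp0
  have hAB : (law n p).real {ω | ∃ J J' : Finset (Fin n), J ⊆ J' ∧ J.card = h ∧ J'.card = m ∧
      ((singleRows ω J (J' \ J)).card : ℝ) ≤ κ} ≤ (law n p).real A + (law n p).real B := by
    refine (measureReal_mono (fun ω hω => ?_) (measure_ne_top _ _)).trans (measureReal_union_le A B)
    obtain ⟨J, J', hJJ, hJ, hJ', hω⟩ := hω
    rcases le_total ((singleRows ω J ∅).card : ℝ) T with hT | hT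
    · exact Or.inl ⟨J, hJ, hT⟩
    · exact Or.inr ⟨J, J', hJJ, hJ, hJ', hT, hω⟩
  refine hAB.trans (add_le_add (hA.trans ?_) (hB.trans ?_))
  · rw [add_sub_assoc, Real.exp_add]
    gcongr
    exact choose_le_exp hn hh
  · rw [add_assoc, mul_add, Real.exp_add (m * (1 + Real.log n - Real.log m) + m * Real.log 2),
      Real.exp_add (m * (1 + Real.log n - Real.log m)), Real.exp_nat_mul (Real.log 2), Real.exp_log (by norm_num)]
    push_cast
    gcongr
    exact choose_le_exp hn hm

/-! ### Low columns and zero columns -/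

lemma mem_lowColumns_iff {n : ℕ} (ω : Sample n) (k : ℕ) (j : Fin n) :
    j ∈ lowColumns (toMatrix ω) k ↔ hits (col ω j) Finset.univ ≤ k := by
  have h : (Finset.univ.filter fun i => toMatrix ω i j ≠ 0) =
      Finset.univ.filter fun i => col ω j i = true := by
    ext i
    rw [Finset.mem_filter_univ, Finset.mem_filter_univ]
    simp [toMatrix, col]
  rw [lowColumns, Finset.mem_filter_univ, h, hits]

lemma prod_column {n : ℕ} (ω : Sample n) (u : Fin n) (c : ℝ) :
    ∏ e : Fin n × Fin n, (if e.2 = u then (if ω e = true then c else 1) else 1) =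
      c ^ hits (col ω u) Finset.univ := by
  rw [Fintype.prod_prod_type, pow_hits]
  refine Finset.prod_congr rfl fun i _ => ?_
  simp only [Finset.prod_ite_eq', Finset.mem_univ, if_true]
  rfl

/-- Two columns are both low, and prescribed entries are equal to `1`. -/
lemma law_two_low_le {n : ℕ} (p : unitInterval) (S : Finset (Fin n × Fin n)) {u₁ u₂ : Fin n}
    (hu : u₁ ≠ u₂) (k : ℕ) {c : ℝ} (hc0 : 0 < c) (hc1 : c ≤ 1) :
    (law n p).real {ω | (∀ e ∈ S, ω e = true) ∧ hits (col ω u₁) Finset.univ ≤ k ∧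
        hits (col ω u₂) Finset.univ ≤ k} ≤
      c⁻¹ ^ (2 * k) * ((p : ℝ) ^ S.card * Real.exp (-((p : ℝ) * (1 - c) * (2 * n - S.card)))) := by
  have hp0 := p.2.1
  have hp1 := p.2.2
  set g : Fin n × Fin n → Bool → ℝ := fun e b => if e ∈ S then (if b = true then 1 else 0) else
    (if e.2 = u₁ ∨ e.2 = u₂ then (if b = true then c else 1) else 1) with hg
  refine (law_real_le_mean (f := fun ω => c⁻¹ ^ (2 * k) * ∏ e, g e (ω e))
    (fun ω => ?_) ?_).trans ?_
  · refine mul_nonneg (by positivity) (Finset.prod_nonneg fun e _ => ?_)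
    simp only [hg]; split_ifs <;> positivity
  · rintro ω ⟨hS, h1, h2⟩
    have hle : c ^ hits (col ω u₁) Finset.univ * c ^ hits (col ω u₂) Finset.univ ≤
        ∏ e, g e (ω e) := by
      rw [← prod_column, ← prod_column, ← Finset.prod_mul_distrib]
      refine Finset.prod_le_prod (fun e _ => ?_) fun e _ => ?_
      · split_ifs <;> positivity
      · have hne : ¬ (e.2 = u₁ ∧ e.2 = u₂) := fun h => hu (h.1.symm.trans h.2)
        by_cases heS : e ∈ S
        · have := hS e heS
          simp only [hg, heS, this, if_true]
          split_ifs <;> nlinarith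
        · simp only [hg, heS, if_false]
          by_cases ha : e.2 = u₁ <;> by_cases hb : e.2 = u₂
          · exact absurd ⟨ha, hb⟩ hne
          · rw [if_pos ha, if_neg hb, if_pos (Or.inl ha), mul_one]
          · rw [if_neg ha, if_pos hb, if_pos (Or.inr hb), one_mul]
          · rw [if_neg ha, if_neg hb, if_neg (by tauto), mul_one]
    have h3 : c ^ (2 * k) ≤ c ^ hits (col ω u₁) Finset.univ * c ^ hits (col ω u₂) Finset.univ := by
      rw [← pow_add]
      exact pow_le_pow_of_le_one hc0.le hc1 (by omega)
    rw [inv_pow, inv_mul_eq_div, one_le_div (by positivity)]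
    exact h3.trans hle
  · rw [mean_const_mul, mean_prod g]
    gcongr
    set U : Finset (Fin n × Fin n) := Finset.univ.filter fun e => e.2 = u₁ ∨ e.2 = u₂ with hU
    have hUcard : U.card = 2 * n := by
      have : U = Finset.univ ×ˢ ({u₁, u₂} : Finset (Fin n)) := by
        ext e; simp [hU]
      rw [this, Finset.card_product, Finset.card_pair hu, Finset.card_univ, Fintype.card_fin,
        mul_comm]
    have hle : ∏ e, ((p : ℝ) * g e true + (1 - p) * g e false) ≤
        ∏ e, (if e ∈ S then (p : ℝ) else 1) *
          (if e ∈ U \ S then Real.exp (-((p : ℝ) * (1 - c))) else 1) := by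
      refine Finset.prod_le_prod (fun e _ => ?_) fun e _ => ?_
      · have : 0 ≤ 1 - (p : ℝ) := by linarith
        have hgn : ∀ b, 0 ≤ g e b := fun b => by
          simp only [hg]; split_ifs <;> positivity
        have := hgn true; have := hgn false
        positivity
      · by_cases heS : e ∈ S
        · simp [hg, heS]
        · by_cases heU : e ∈ U
          · have heU' : e.2 = u₁ ∨ e.2 = u₂ := by simpa [hU] using heU
            simp only [hg, heS, heU', Finset.mem_sdiff, heU, if_true, if_false, not_false_iff,
              and_self, one_mul]
            have := Real.add_one_le_exp (-((p : ℝ) * (1 - c)))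
            simp only [Bool.false_eq_true, if_false]
            linarith
          · have heU' : ¬ (e.2 = u₁ ∨ e.2 = u₂) := by simpa [hU] using heU
            simp only [hg, heS, heU', Finset.mem_sdiff, heU, if_false, false_and]
            linarith
    refine hle.trans ?_
    rw [Finset.prod_mul_distrib, Finset.prod_ite_mem, Finset.prod_ite_mem, Finset.univ_inter,
      Finset.univ_inter, Finset.prod_const, Finset.prod_const, ← Real.exp_nat_mul]
    gcongr
    have h4 : 2 * n ≤ (U \ S).card + S.card := by
      rw [← hUcard]
      exact Finset.card_le_card_sdiff_add_card
    have h4' : (2 * n : ℝ) ≤ (U \ S).card + S.card := by exact_mod_cast h4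
    have h5 : 0 ≤ (p : ℝ) * (1 - c) := mul_nonneg hp0 (by linarith)
    nlinarith

/-- Two distinct low columns share a row, or two distinct low columns are both met, in distinct
rows, by one further column. -/
def lowClash {n : ℕ} (ω : Sample n) (k : ℕ) : Prop :=
  ∃ u₁ u₂ : Fin n, u₁ ≠ u₂ ∧ hits (col ω u₁) Finset.univ ≤ k ∧ hits (col ω u₂) Finset.univ ≤ k ∧
    ((∃ i, ω (i, u₁) = true ∧ ω (i, u₂) = true) ∨
      ∃ v i₁ i₂, v ≠ u₁ ∧ v ≠ u₂ ∧ i₁ ≠ i₂ ∧ ω (i₁, u₁) = true ∧ ω (i₁, v) = true ∧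
        ω (i₂, u₂) = true ∧ ω (i₂, v) = true)

lemma law_lowClash_le {n : ℕ} (p : unitInterval) (k : ℕ) (hn : 0 < n)
    (hu : 1 ≤ (p : ℝ) * n) (hL : Real.log n ≤ p * n) (hp : 4 * (p : ℝ) ≤ 1) :
    (law n p).real {ω | lowClash ω k} ≤
      2 * Real.exp 3 * ((p : ℝ) * n) ^ (2 * k + 4) * (n : ℝ)⁻¹ := by
  have hp0 := p.2.1
  have hn0 : (0 : ℝ) < n := by exact_mod_cast hn
  set u := (p : ℝ) * n with hudef
  have hu0 : 0 < u := by linarith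
  -- the bound for a prescribed set of at most four entries, with the weight `1 / u`
  have key : ∀ (S : Finset (Fin n × Fin n)) (u₁ u₂ : Fin n), u₁ ≠ u₂ → S.card ≤ 4 →
      (law n p).real {ω | (∀ e ∈ S, ω e = true) ∧ hits (col ω u₁) Finset.univ ≤ k ∧
        hits (col ω u₂) Finset.univ ≤ k} ≤
        u ^ (2 * k) * (p : ℝ) ^ S.card * (Real.exp 3 * ((n : ℝ)⁻¹ * (n : ℝ)⁻¹)) := by
    intro S u₁ u₂ hne hS
    refine (law_two_low_le p S hne k (c := u⁻¹) (by positivity) (inv_le_one_of_one_le₀ hu)).trans ?_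
    rw [inv_inv, ← mul_assoc]
    gcongr
    have h1 : Real.exp (-u) ≤ (n : ℝ)⁻¹ := by
      rw [Real.exp_neg]
      gcongr
      rwa [← Real.log_le_iff_le_exp hn0]
    have hS' : (S.card : ℝ) ≤ 4 := by exact_mod_cast hS
    calc _ ≤ Real.exp (3 + (-u + -u)) := by
          gcongr
          have h2 : (p : ℝ) * (1 - u⁻¹) * (2 * n - S.card) =
            2 * u - 2 * (u * u⁻¹) - S.card * p * (1 - u⁻¹) := by rw [hudef]; ring
          rw [h2, mul_inv_cancel₀ hu0.ne']
          have h3 : 0 ≤ u⁻¹ := by positivity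
          have h4 : S.card * (p : ℝ) ≤ 1 := by nlinarith
          have h5 : 0 ≤ S.card * (p : ℝ) := by positivity
          nlinarith
      _ ≤ _ := by
          rw [Real.exp_add, Real.exp_add]
          gcongr
  set A : Set (Sample n) := {ω | ∃ u₁ u₂ : Fin n, u₁ ≠ u₂ ∧ hits (col ω u₁) Finset.univ ≤ k ∧
    hits (col ω u₂) Finset.univ ≤ k ∧ ∃ i, ω (i, u₁) = true ∧ ω (i, u₂) = true}
  set B : Set (Sample n) := {ω | ∃ u₁ u₂ : Fin n, u₁ ≠ u₂ ∧ hits (col ω u₁) Finset.univ ≤ k ∧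
    hits (col ω u₂) Finset.univ ≤ k ∧ ∃ v i₁ i₂, v ≠ u₁ ∧ v ≠ u₂ ∧ i₁ ≠ i₂ ∧
      ω (i₁, u₁) = true ∧ ω (i₁, v) = true ∧ ω (i₂, u₂) = true ∧ ω (i₂, v) = true}
  have hA : (law n p).real A ≤ (n ^ 3 : ℕ) *
      (u ^ (2 * k) * (p : ℝ) ^ 2 * (Real.exp 3 * ((n : ℝ)⁻¹ * (n : ℝ)⁻¹))) := by
    have hcard : (Finset.univ.filter fun q : Fin n × Fin n × Fin n => q.1 ≠ q.2.1).card ≤ n ^ 3 := by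
      refine (Finset.card_le_univ _).trans (le_of_eq ?_)
      simp [Fintype.card_prod]; ring
    refine (law_union_le (p := p) (Finset.univ.filter fun q : Fin n × Fin n × Fin n => q.1 ≠ q.2.1)
      (fun q => {ω | (∀ e ∈ ({(q.2.2, q.1), (q.2.2, q.2.1)} : Finset (Fin n × Fin n)), ω e = true) ∧
        hits (col ω q.1) Finset.univ ≤ k ∧ hits (col ω q.2.1) Finset.univ ≤ k}) A
      (c := u ^ (2 * k) * (p : ℝ) ^ 2 * (Real.exp 3 * ((n : ℝ)⁻¹ * (n : ℝ)⁻¹))) ?_ ?_).trans ?_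
    · rintro ω ⟨u₁, u₂, hne, h1, h2, i, h3, h4⟩
      exact ⟨(u₁, u₂, i), by simp [hne], by simp [h3, h4], h1, h2⟩
    · rintro ⟨u₁, u₂, i⟩ hq
      have hne : u₁ ≠ u₂ := by simpa using hq
      have hc : ({(i, u₁), (i, u₂)} : Finset (Fin n × Fin n)).card = 2 :=
        Finset.card_pair (by simp [hne])
      have := key {(i, u₁), (i, u₂)} u₁ u₂ hne (by rw [hc]; norm_num)
      rwa [hc] at this
    · gcongr
  have hB : (law n p).real B ≤ (n ^ 5 : ℕ) *
      (u ^ (2 * k) * (p : ℝ) ^ 4 * (Real.exp 3 * ((n : ℝ)⁻¹ * (n : ℝ)⁻¹))) := by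
    set Q : Finset (Fin n × Fin n × Fin n × Fin n × Fin n) := Finset.univ.filter fun q =>
      q.1 ≠ q.2.1 ∧ q.2.2.1 ≠ q.1 ∧ q.2.2.1 ≠ q.2.1 ∧ q.2.2.2.1 ≠ q.2.2.2.2
    have hcard : Q.card ≤ n ^ 5 := by
      refine (Finset.card_le_univ _).trans (le_of_eq ?_)
      simp [Fintype.card_prod]; ring
    refine (law_union_le (p := p) Q
      (fun q => {ω | (∀ e ∈ ({(q.2.2.2.1, q.1), (q.2.2.2.1, q.2.2.1), (q.2.2.2.2, q.2.1),
        (q.2.2.2.2, q.2.2.1)} : Finset (Fin n × Fin n)), ω e = true) ∧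
        hits (col ω q.1) Finset.univ ≤ k ∧ hits (col ω q.2.1) Finset.univ ≤ k}) B
      (c := u ^ (2 * k) * (p : ℝ) ^ 4 * (Real.exp 3 * ((n : ℝ)⁻¹ * (n : ℝ)⁻¹))) ?_ ?_).trans ?_
    · rintro ω ⟨u₁, u₂, hne, h1, h2, v, i₁, i₂, hv1, hv2, hi, h3, h4, h5, h6⟩
      exact ⟨(u₁, u₂, v, i₁, i₂), by simp [Q, hne, hv1, hv2, hi], by simp [h3, h4, h5, h6], h1, h2⟩
    · rintro ⟨u₁, u₂, v, i₁, i₂⟩ hq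
      obtain ⟨hne, hv1, hv2, hi⟩ : u₁ ≠ u₂ ∧ v ≠ u₁ ∧ v ≠ u₂ ∧ i₁ ≠ i₂ := by simpa [Q] using hq
      have hc : ({(i₁, u₁), (i₁, v), (i₂, u₂), (i₂, v)} : Finset (Fin n × Fin n)).card = 4 := by
        rw [Finset.card_insert_of_notMem, Finset.card_insert_of_notMem, Finset.card_pair]
        · simp [hv2.symm]
        · simp [hi]
        · simp [hi, hv1.symm]
      have := key {(i₁, u₁), (i₁, v), (i₂, u₂), (i₂, v)} u₁ u₂ hne hc.le
      rwa [hc] at this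
    · gcongr
  have hAB : (law n p).real {ω | lowClash ω k} ≤ (law n p).real A + (law n p).real B := by
    refine (measureReal_mono (fun ω hω => ?_) (measure_ne_top _ _)).trans (measureReal_union_le A B)
    obtain ⟨u₁, u₂, hne, h1, h2, h | h⟩ := hω
    · exact Or.inl ⟨u₁, u₂, hne, h1, h2, h⟩
    · exact Or.inr ⟨u₁, u₂, hne, h1, h2, h⟩
  refine hAB.trans ((add_le_add hA hB).trans ?_)
  push_cast
  have e1 : (n : ℝ) ^ 3 * (u ^ (2 * k) * (p : ℝ) ^ 2 * (Real.exp 3 * ((n : ℝ)⁻¹ * (n : ℝ)⁻¹))) =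
      Real.exp 3 * u ^ (2 * k + 2) * (n : ℝ)⁻¹ := by
    rw [pow_add, hudef]; field_simp
  have e2 : (n : ℝ) ^ 5 * (u ^ (2 * k) * (p : ℝ) ^ 4 * (Real.exp 3 * ((n : ℝ)⁻¹ * (n : ℝ)⁻¹))) =
      Real.exp 3 * u ^ (2 * k + 4) * (n : ℝ)⁻¹ := by
    rw [pow_add, hudef]; field_simp
  rw [e1, e2]
  have e3 : Real.exp 3 * u ^ (2 * k + 2) * (n : ℝ)⁻¹ ≤ Real.exp 3 * u ^ (2 * k + 4) * (n : ℝ)⁻¹ := by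
    gcongr
    norm_num
  linarith

open Classical in
/-- The probability of exactly `β` zero columns bounds that of at least `β` from below. -/
lemma le_law_compl_fewZeroColumns (n β : ℕ) (p : unitInterval) :
    (n.choose β : ℝ) * (((1 - (p : ℝ)) ^ n) ^ β * (1 - (1 - (p : ℝ)) ^ n) ^ (n - β)) ≤
      (law n p).real (fewZeroColumns n β)ᶜ := by
  set q : ℝ := (1 - (p : ℝ)) ^ n with hq
  -- the indicator of the event that `Z` is the set of the zero columns
  have hmean : ∀ Z ∈ (Finset.univ.powersetCard β : Finset (Finset (Fin n))),
      mean (p : ℝ) (fun ω : Sample n => ∏ j, (if j ∈ Z then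
        (0 : ℝ) ^ hits (col ω j) Finset.univ else 1 - (0 : ℝ) ^ hits (col ω j) Finset.univ)) =
      q ^ β * (1 - q) ^ (n - β) := by
    intro Z hZ
    have hZc := (Finset.mem_powersetCard.1 hZ).2
    have h1 := mean_prod_cols (p := (p : ℝ)) (fun (j : Fin n) (r : Fin n → Bool) =>
      if j ∈ Z then (0 : ℝ) ^ hits r Finset.univ else 1 - (0 : ℝ) ^ hits r Finset.univ)
    have h0 : mean (p : ℝ) (fun r : Fin n → Bool => (0 : ℝ) ^ hits r Finset.univ) = q := by
      rw [mean_pow_hits]; simp [hq]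
    have h2 : ∀ j : Fin n, mean (p : ℝ) (fun r : Fin n → Bool =>
        if j ∈ Z then (0 : ℝ) ^ hits r Finset.univ else 1 - (0 : ℝ) ^ hits r Finset.univ) =
        if j ∈ Z then q else 1 - q := by
      intro j
      split_ifs
      · exact h0
      · have h3 : ∀ r : Fin n → Bool, 1 - (0 : ℝ) ^ hits r Finset.univ =
          1 + (-1) * (0 : ℝ) ^ hits r Finset.univ := fun r => by ring
        simp only [h3]
        rw [mean_add, mean_one, mean_const_mul, h0]; ring
    refine h1.trans ?_
    rw [Finset.prod_congr rfl fun j _ => h2 j, Finset.prod_ite, Finset.prod_const,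
      Finset.prod_const]
    have h4 : (Finset.univ.filter fun j => j ∈ Z) = Z := by ext; simp
    have h5 : (Finset.univ.filter fun j => j ∉ Z) = Zᶜ := by ext; simp
    rw [h4, h5, Finset.card_compl, hZc, Fintype.card_fin]
  have hsum : (n.choose β : ℝ) * (q ^ β * (1 - q) ^ (n - β)) =
      mean (p : ℝ) (fun ω : Sample n => ∑ Z ∈ (Finset.univ.powersetCard β : Finset (Finset (Fin n))),
        ∏ j, (if j ∈ Z then (0 : ℝ) ^ hits (col ω j) Finset.univ
          else 1 - (0 : ℝ) ^ hits (col ω j) Finset.univ)) := by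
    rw [mean_sum, Finset.sum_congr rfl hmean]
    simp
  rw [hsum, law_real_eq_mean]
  refine mean_mono p.2.1 p.2.2 fun ω => ?_
  have hprod : ∀ Z : Finset (Fin n), (∏ j, (if j ∈ Z then (0 : ℝ) ^ hits (col ω j) Finset.univ
          else 1 - (0 : ℝ) ^ hits (col ω j) Finset.univ)) =
      if Z = lowColumns (toMatrix ω) 0 then 1 else 0 := by
    intro Z
    split_ifs with hZ
    · refine Finset.prod_eq_one fun j _ => ?_
      have := mem_lowColumns_iff ω 0 j
      rw [← hZ] at this
      by_cases hj : j ∈ Z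
      · have h0 : hits (col ω j) Finset.univ = 0 := Nat.le_zero.1 (this.1 hj)
        simp [hj, h0]
      · have h0 : hits (col ω j) Finset.univ ≠ 0 := fun h => hj (this.2 h.le)
        simp [hj, h0]
    · have : ∃ j, ¬ (j ∈ Z ↔ j ∈ lowColumns (toMatrix ω) 0) := by
        by_contra! h
        exact hZ (Finset.ext h)
      obtain ⟨j, hj⟩ := this
      refine Finset.prod_eq_zero (Finset.mem_univ j) ?_
      rw [mem_lowColumns_iff, Nat.le_zero] at hj
      by_cases hjZ : j ∈ Z
      · have h0 : hits (col ω j) Finset.univ ≠ 0 := by tauto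
        simp [hjZ, h0]
      · have h0 : hits (col ω j) Finset.univ = 0 := by tauto
        simp [hjZ, h0]
  simp only [hprod, Finset.sum_ite_eq']
  by_cases h : (lowColumns (toMatrix ω) 0) ∈ (Finset.univ.powersetCard β : Finset (Finset (Fin n)))
  · rw [if_pos h, if_pos]
    have := (Finset.mem_powersetCard.1 h).2
    simp [fewZeroColumns, this]
  · rw [if_neg h]
    split_ifs <;> norm_num

/-! ### Large entries of `A x` -/

section Rearrangement

variable {n : ℕ} (x : EuclideanSpace ℝ (Fin n))

/-- The positions of the `m` largest of the numbers `|x i|`, with the ties broken as in `rearr`. -/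
noncomputable def topSet (m : ℕ) : Finset (Fin n) :=
  Finset.univ.filter fun i => ((Tuple.sort fun i => -|x i|).symm i).val < m

lemma abs_sort_antitone {i j : Fin n} (h : i ≤ j) :
    |x (Tuple.sort (fun i => -|x i|) j)| ≤ |x (Tuple.sort (fun i => -|x i|) i)| := by
  have := Tuple.monotone_sort (fun i => -|x i|) h
  simpa using this

lemma card_topSet {m : ℕ} (hm : m ≤ n) : (topSet x m).card = m := by
  have : topSet x m = (Finset.univ.filter fun i : Fin n => i.val < m).map
      (Tuple.sort fun i => -|x i|).toEmbedding := by
    ext i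
    simp only [topSet, Finset.mem_filter_univ, Finset.mem_map, Equiv.coe_toEmbedding]
    constructor
    · intro h
      exact ⟨_, h, by simp⟩
    · rintro ⟨j, hj, rfl⟩
      simpa using hj
  rw [this, Finset.card_map, Fin.card_filter_val_lt, min_eq_right hm]

lemma topSet_mono {h m : ℕ} (hm : h ≤ m) : topSet x h ⊆ topSet x m := by
  intro i hi
  simp only [topSet, Finset.mem_filter_univ] at hi ⊢
  omega

lemma rearr_le_of_mem_topSet {m : ℕ} (hm : m ≤ n) {i : Fin n} (hi : i ∈ topSet x m) :
    rearr x m ≤ |x i| := by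
  simp only [topSet, Finset.mem_filter_univ] at hi
  have h1 : m - 1 < n := by omega
  rw [rearr, dif_pos h1]
  set r := (Tuple.sort fun i => -|x i|).symm i
  have := abs_sort_antitone x (i := r) (j := ⟨m - 1, h1⟩)
    (Fin.le_def.2 (show r.val ≤ m - 1 by omega))
  simpa [r] using this

lemma le_rearr_of_notMem_topSet {m : ℕ} {i : Fin n} (hi : i ∉ topSet x m) :
    |x i| ≤ rearr x m := by
  simp only [topSet, Finset.mem_filter_univ, not_lt] at hi
  set r := (Tuple.sort fun i => -|x i|).symm i
  have h2 := r.isLt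
  have h1 : m - 1 < n := by omega
  rw [rearr, dif_pos h1]
  have := abs_sort_antitone x (i := ⟨m - 1, h1⟩) (j := r)
    (Fin.le_def.2 (show m - 1 ≤ r.val by omega))
  simpa [r] using this

lemma rearr_nonneg (m : ℕ) : 0 ≤ rearr x m := by
  unfold rearr; split_ifs <;> positivity

lemma rearr_anti {h m : ℕ} (hm : h ≤ m) : rearr x m ≤ rearr x h := by
  by_cases h1 : m - 1 < n
  · have h2 : h - 1 < n := by omega
    rw [rearr, rearr, dif_pos h1, dif_pos h2]
    exact abs_sort_antitone x (Fin.mk_le_mk.2 (by omega))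
  · conv_lhs => rw [rearr, dif_neg h1]
    exact rearr_nonneg x h

end Rearrangement

section Rows

variable {n : ℕ} {ω : Sample n} {x : EuclideanSpace ℝ (Fin n)}

lemma mulVec_apply_eq (ω : Sample n) (x : EuclideanSpace ℝ (Fin n)) (i : Fin n) :
    (toMatrix ω).mulVec x.ofLp i = ∑ j ∈ Finset.univ.filter (fun j => ω (i, j) = true), x j := by
  rw [Finset.sum_filter, Matrix.mulVec, dotProduct]
  refine Finset.sum_congr rfl fun j _ => ?_
  simp [toMatrix]

/-- In a row with a `1` in the column `u`, the entry of `A x` is at least `|x u|` less the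
contribution of the other columns of `J'` and that of the columns outside `J'`. -/
lemma abs_mulVec_ge {i u : Fin n} {J' : Finset (Fin n)} {M τ s : ℝ} {N : ℕ}
    (hu : ω (i, u) = true) (hM : (hits (row ω i) Finset.univ : ℝ) ≤ M) (hτ0 : 0 ≤ τ)
    (hτ : ∀ j ∉ J', |x j| ≤ τ) (hs0 : 0 ≤ s)
    (hs : ∀ j ∈ J', j ≠ u → ω (i, j) = true → |x j| ≤ s)
    (hN : (J'.filter fun j => j ≠ u ∧ ω (i, j) = true).card ≤ N) :
    |x u| - N * s - M * τ ≤ |(toMatrix ω).mulVec x.ofLp i| := by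
  rw [mulVec_apply_eq]
  set F := Finset.univ.filter (fun j => ω (i, j) = true) with hF
  have huF : u ∈ F := by simp [hF, hu]
  rw [← Finset.add_sum_erase _ _ huF]
  have h1 : |∑ j ∈ F.erase u, x j| ≤ N * s + M * τ := by
    refine (Finset.abs_sum_le_sum_abs _ _).trans ?_
    rw [← Finset.sum_filter_add_sum_filter_not (F.erase u) (· ∈ J')]
    refine add_le_add ?_ ?_
    · refine (Finset.sum_le_card_nsmul _ _ s fun j hj => ?_).trans ?_
      · simp only [Finset.mem_filter, Finset.mem_erase, hF, Finset.mem_univ, true_and] at hj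
        exact hs j hj.2 hj.1.1 hj.1.2
      · rw [nsmul_eq_mul]
        gcongr
        refine le_trans (Finset.card_le_card fun j hj => ?_) hN
        simp only [Finset.mem_filter, Finset.mem_erase, hF, Finset.mem_univ, true_and] at hj ⊢
        tauto
    · refine (Finset.sum_le_card_nsmul _ _ τ fun j hj => hτ j (Finset.mem_filter.1 hj).2).trans ?_
      rw [nsmul_eq_mul]
      gcongr
      refine le_trans ?_ hM
      have : ((F.erase u).filter fun j => j ∉ J').card ≤ hits (row ω i) Finset.univ := by
        refine Finset.card_le_card fun j hj => ?_
        simp only [Finset.mem_filter, Finset.mem_erase, hF, Finset.mem_univ, true_and] at hj ⊢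
        exact hj.1.2
      exact_mod_cast this
  have h2 := abs_sub_abs_le_abs_sub (x u) (-∑ j ∈ F.erase u, x j)
  rw [abs_neg, sub_neg_eq_add] at h2
  linarith

lemma hits_pos_iff {ι : Type*} {r : ι → Bool} {S : Finset ι} :
    0 < hits r S ↔ ∃ j ∈ S, r j = true := by
  simp [hits, Finset.card_pos, Finset.Nonempty, Finset.mem_filter]

lemma hits_mono {ι : Type*} {r : ι → Bool} {S T : Finset ι} (h : S ⊆ T) : hits r S ≤ hits r T :=
  Finset.card_le_card (Finset.filter_subset_filter _ h)

/-- In a row that meets `J'` in a single column, that column determines the size of the entry of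
`A x`. -/
lemma abs_mulVec_ge_of_hits_eq_one {i u : Fin n} {J' : Finset (Fin n)} {M τ : ℝ}
    (hu : ω (i, u) = true) (huJ : u ∈ J') (h1 : hits (row ω i) J' = 1)
    (hM : (hits (row ω i) Finset.univ : ℝ) ≤ M) (hτ0 : 0 ≤ τ)
    (hτ : ∀ j ∉ J', |x j| ≤ τ) : |x u| - M * τ ≤ |(toMatrix ω).mulVec x.ofLp i| := by
  have huniq : ∀ j ∈ J', ω (i, j) = true → j = u := by
    intro j hj hij
    refine Finset.card_le_one.1 h1.le j ?_ u ?_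
    · exact Finset.mem_filter.2 ⟨hj, hij⟩
    · exact Finset.mem_filter.2 ⟨huJ, hu⟩
  have := abs_mulVec_ge (x := x) (J' := J') (s := 0) (N := 0) hu hM hτ0 hτ le_rfl
    (fun j hj hne hij => absurd (huniq j hj hij) hne) ?_
  · simpa using this
  · rw [Nat.le_zero, Finset.card_eq_zero, Finset.filter_eq_empty_iff]
    rintro j hj ⟨hne, hij⟩
    exact hne (huniq j hj hij)

/-- Many rows that meet `J` once and the rest of `J'` never give many large entries of `A x`. -/
lemma many_large_of_singleRows {J J' : Finset (Fin n)} {M τ a κ : ℝ} (hJ : J ⊆ J')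
    (hM : ∀ i, (hits (row ω i) Finset.univ : ℝ) ≤ M) (hτ0 : 0 ≤ τ)
    (ha0 : 0 < a) (ha : ∀ j ∈ J, a ≤ |x j|) (hτ : ∀ j ∉ J', |x j| ≤ τ) (hMτ : M * τ ≤ a / 100)
    (hG : κ < (singleRows ω J (J' \ J)).card) :
    κ < (Finset.univ.filter fun i : Fin n =>
      a / 100 ≤ |(toMatrix ω).mulVec x.ofLp i|).card := by
  refine hG.trans_le (Nat.cast_le.2 (Finset.card_le_card fun i hi => ?_))
  simp only [singleRows, Finset.mem_filter_univ] at hi ⊢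
  obtain ⟨h1, h0⟩ := hi
  obtain ⟨u, huJ, hu⟩ := hits_pos_iff.1 (by omega : 0 < hits (row ω i) J)
  have h2 : hits (row ω i) J' = 1 := by
    have : hits (row ω i) J' = hits (row ω i) J + hits (row ω i) (J' \ J) := by
      unfold hits
      rw [← Finset.card_union_of_disjoint
        (Finset.disjoint_filter_filter Finset.disjoint_sdiff), ← Finset.filter_union,
        Finset.union_sdiff_of_subset hJ]
    omega
  have := abs_mulVec_ge_of_hits_eq_one hu (hJ huJ) h2 (hM i) hτ0 hτ
  have := ha u huJ
  linarith

lemma sum_hits_col (ω : Sample n) (N : Finset (Fin n)) :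
    ∑ v ∈ N, hits (col ω v) Finset.univ = ∑ i, hits (row ω i) N := by
  simp only [hits, Finset.card_filter]
  rw [Finset.sum_comm]
  rfl

/-- The small scales. If `J'` is at most three times as large as `J`, and the rows meet `J'` with
little excess, then either some row through a low column of `J` gives a large entry, or so many
columns of `J'` that are not low carry a large coordinate that many rows meet `J'` in one such
column alone. -/
lemma large_rows_of_small_excess {J J' : Finset (Fin n)} {M τ a : ℝ} {k : ℕ} (hJ : J ⊆ J')
    (hM : ∀ i, (hits (row ω i) Finset.univ : ℝ) ≤ M) (hclash : ¬ lowClash ω k)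
    (hex : excess ω J' ≤ 3 * J'.card) (hcard : J'.card ≤ 3 * J.card) (hJ0 : 0 < J.card)
    (hk : 1000 ≤ k) (hτ0 : 0 ≤ τ) (ha0 : 0 < a) (ha : ∀ j ∈ J, a ≤ |x j|)
    (hτ : ∀ j ∉ J', |x j| ≤ τ) (hMτ : M * τ ≤ a / 100)
    (hzero : ∀ j ∈ lowColumns (toMatrix ω) 0, x j = 0) :
    (∃ i ∈ lowRows (toMatrix ω) k, a / 100 ≤ |(toMatrix ω).mulVec x.ofLp i|) ∨
      (k : ℝ) / 8 < (Finset.univ.filter fun i : Fin n =>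
        a / 100 ≤ |(toMatrix ω).mulVec x.ofLp i|).card := by
  classical
  by_cases hcase : ∃ i ∈ lowRows (toMatrix ω) k, a / 100 ≤ |(toMatrix ω).mulVec x.ofLp i|
  · exact Or.inl hcase
  right
  push Not at hcase
  set low : Fin n → Prop := fun u => hits (col ω u) Finset.univ ≤ k with hlow
  set JL := J.filter low with hJL
  have hrow : ∀ u, ∃ i, u ∈ JL → ω (i, u) = true := by
    intro u
    by_cases hu : u ∈ JL
    · have hxu : x u ≠ 0 := by
        intro h
        have := ha u (Finset.mem_filter.1 hu).1
        rw [h, abs_zero] at this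
        linarith
      have hpos : 0 < hits (col ω u) Finset.univ := by
        by_contra h
        exact hxu (hzero u ((mem_lowColumns_iff ω 0 u).2 (by omega)))
      obtain ⟨i, -, hi⟩ := hits_pos_iff.1 hpos
      exact ⟨i, fun _ => hi⟩
    · exact ⟨u, fun h => absurd h hu⟩
  choose ρ hρ using hrow
  -- the columns of `J'` that meet the chosen row of `u`
  set B : Fin n → Finset (Fin n) := fun u => J'.filter fun v => v ≠ u ∧ ω (ρ u, v) = true with hB
  set N := J'.filter fun v => ¬ low v ∧ a / 26 ≤ |x v| with hN
  -- no clash: blocking columns are not low, and no column blocks two low columns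
  have hBlow : ∀ u ∈ JL, ∀ v ∈ B u, ¬ low v := by
    intro u hu v hv hlv
    have hv' := (Finset.mem_filter.1 hv).2
    exact hclash ⟨u, v, hv'.1.symm, (Finset.mem_filter.1 hu).2, hlv, Or.inl ⟨ρ u, hρ u hu, hv'.2⟩⟩
  have hBdisj : ∀ u ∈ JL, ∀ u' ∈ JL, u ≠ u' → Disjoint (B u) (B u') := by
    intro u hu u' hu' hne
    rw [Finset.disjoint_left]
    intro v hv hv'
    have h1 := (Finset.mem_filter.1 hv).2
    have h2 := (Finset.mem_filter.1 hv').2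
    have hlu := (Finset.mem_filter.1 hu).2
    have hlu' := (Finset.mem_filter.1 hu').2
    by_cases hρρ : ρ u = ρ u'
    · exact hclash ⟨u, u', hne, hlu, hlu', Or.inl ⟨ρ u, hρ u hu, hρρ ▸ hρ u' hu'⟩⟩
    · exact hclash ⟨u, u', hne, hlu, hlu', Or.inr ⟨v, ρ u, ρ u', h1.1, h2.1, hρρ, hρ u hu, h1.2,
        hρ u' hu', h2.2⟩⟩
  -- at most twelve blocking columns with coordinates below `a / 26` cannot cancel `x u`
  have hB13 : ∀ u ∈ JL, 13 ≤ (B u).card + 13 * (B u ∩ N).card := by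
    intro u hu
    by_contra hlt
    have hBN : (B u ∩ N).card = 0 := by omega
    have hB12 : (B u).card ≤ 12 := by omega
    rw [Finset.card_eq_zero] at hBN
    have huJ := (Finset.mem_filter.1 hu).1
    have h1 := abs_mulVec_ge (x := x) (J' := J') (s := a / 26) (N := 12) (hρ u hu) (hM _) hτ0 hτ
      (by positivity) ?_ hB12
    · have h2 : ρ u ∈ lowRows (toMatrix ω) k := by
        simp only [lowRows, Finset.mem_filter_univ]
        exact ⟨u, (mem_lowColumns_iff ω k u).2 (Finset.mem_filter.1 hu).2,
          by simp [toMatrix, hρ u hu]⟩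
      have h3 := hcase _ h2
      have h4 := ha u huJ
      push_cast at h1
      linarith
    · intro v hv hne hvi
      by_contra hgt
      have hvB : v ∈ B u := Finset.mem_filter.2 ⟨hv, hne, hvi⟩
      have hvN : v ∈ N := Finset.mem_filter.2 ⟨hv, hBlow u hu v hvB, by linarith⟩
      have : v ∈ B u ∩ N := Finset.mem_inter.2 ⟨hvB, hvN⟩
      rw [hBN] at this
      exact absurd this (Finset.notMem_empty _)
  have hsumB : ∑ u ∈ JL, (B u).card ≤ J'.card := by
    rw [← Finset.card_biUnion hBdisj]
    exact Finset.card_le_card (Finset.biUnion_subset.2 fun u _ => Finset.filter_subset _ _)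
  have hsumBN : ∑ u ∈ JL, (B u ∩ N).card ≤ N.card := by
    rw [← Finset.card_biUnion fun u hu u' hu' hne => (hBdisj u hu u' hu' hne).mono
      Finset.inter_subset_left Finset.inter_subset_left]
    exact Finset.card_le_card (Finset.biUnion_subset.2 fun u _ => Finset.inter_subset_right)
  have hJLcard : 13 * JL.card ≤ J'.card + 13 * N.card := by
    calc 13 * JL.card = ∑ u ∈ JL, 13 := by simp [mul_comm]
      _ ≤ ∑ u ∈ JL, ((B u).card + 13 * (B u ∩ N).card) := Finset.sum_le_sum hB13
      _ ≤ _ := by rw [Finset.sum_add_distrib, ← Finset.mul_sum]; omega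
  have hJcard : J.card ≤ JL.card + N.card := by
    rw [← Finset.card_filter_add_card_filter_not (s := J) low]
    refine Nat.add_le_add_left (Finset.card_le_card fun v hv => ?_) _
    obtain ⟨hvJ, hvl⟩ := Finset.mem_filter.1 hv
    exact Finset.mem_filter.2 ⟨hJ hvJ, hvl, by linarith [ha v hvJ]⟩
  -- the rows that meet `J'` in a single column, which belongs to `N`
  set G : Finset (Fin n) := Finset.univ.filter fun i =>
    hits (row ω i) J' = 1 ∧ 0 < hits (row ω i) N with hG
  have hones : (k + 1) * N.card ≤ G.card + 2 * excess ω J' := by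
    calc (k + 1) * N.card ≤ ∑ v ∈ N, hits (col ω v) Finset.univ := by
          rw [mul_comm, ← smul_eq_mul]
          refine Finset.card_nsmul_le_sum _ _ _ fun v hv => ?_
          have := (Finset.mem_filter.1 hv).2.1
          simp only [hlow] at this
          omega
      _ = ∑ i, hits (row ω i) N := sum_hits_col ω N
      _ ≤ ∑ i, ((if hits (row ω i) J' = 1 ∧ 0 < hits (row ω i) N then 1 else 0) +
            2 * (hits (row ω i) J' - 1)) := by
          refine Finset.sum_le_sum fun i _ => ?_
          -- a row with `r ≥ 2` ones in `J'` has `r ≤ 2 (r - 1)`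
          have : hits (row ω i) N ≤ hits (row ω i) J' := hits_mono (Finset.filter_subset _ _)
          split_ifs <;> omega
      _ = _ := by
          rw [Finset.sum_add_distrib, ← Finset.mul_sum, hG, Finset.card_filter]
          rfl
  have hGsub : G ⊆ Finset.univ.filter fun i : Fin n =>
      a / 100 ≤ |(toMatrix ω).mulVec x.ofLp i| := by
    intro i hi
    simp only [hG, Finset.mem_filter_univ] at hi ⊢
    obtain ⟨v, hvN, hv⟩ := hits_pos_iff.1 hi.2
    obtain ⟨hvJ, -, hva⟩ := Finset.mem_filter.1 hvN
    have := abs_mulVec_ge_of_hits_eq_one hv hvJ hi.1 (hM i) hτ0 hτ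
    linarith
  -- the excess is at most `3 * J'.card ≤ 9 * J.card`, and `10 * J.card ≤ 26 * N.card`
  have hGcard : k < 8 * G.card := by
    have hN0 : 0 < N.card := by omega
    have h5 : (k + 1) * N.card ≤ G.card + 47 * N.card := by omega
    obtain ⟨t, ht⟩ : ∃ t, N.card = t + 1 := ⟨N.card - 1, by omega⟩
    rw [ht] at h5
    have h6 : 47 * t ≤ (k + 1) * t := Nat.mul_le_mul_right t (by omega)
    have h7 : (k + 1) * (t + 1) = (k + 1) * t + (k + 1) := by ring
    omega
  have h7 : (G.card : ℝ) ≤ (Finset.univ.filter fun i : Fin n =>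
      a / 100 ≤ |(toMatrix ω).mulVec x.ofLp i|).card := by exact_mod_cast Finset.card_le_card hGsub
  have h8 : (k : ℝ) < 8 * G.card := by exact_mod_cast hGcard
  linarith

lemma le_norm_of_mem_lowRows {k : ℕ} {i : Fin n} (hi : i ∈ lowRows (toMatrix ω) k) :
    |(toMatrix ω).mulVec x.ofLp i| ≤
      ‖WithLp.toLp 2 (((toMatrix ω).submatrix
        (Subtype.val : lowRows (toMatrix ω) k → Fin n) id).mulVec x.ofLp)‖ :=
  PiLp.norm_apply_le (WithLp.toLp 2 (((toMatrix ω).submatrix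
        (Subtype.val : lowRows (toMatrix ω) k → Fin n) id).mulVec x.ofLp)) ⟨i, hi⟩

end Rows

/-! ### The scales and the norm of a steep vector -/

section Scales

variable {n : ℕ} {p γ : ℝ}

lemma t₀_spec (hE : 4 ≤ baseScale n p) :
    1 ≤ t₀ n p ∧ 3 ^ (t₀ n p - 1) < baseScale n p ∧ baseScale n p ≤ 3 ^ t₀ n p := by
  have hex : ∃ t, baseScale n p ≤ 3 ^ t := ⟨baseScale n p, (Nat.lt_pow_self (by norm_num)).le⟩
  have hne : {t : ℕ | 1 ≤ t ∧ 3 ^ (t - 1) < baseScale n p ∧ baseScale n p ≤ 3 ^ t}.Nonempty := by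
    classical
    have h1 : 1 ≤ Nat.find hex := by
      rw [Nat.one_le_iff_ne_zero]
      intro h
      have := Nat.find_spec hex
      rw [h] at this
      omega
    refine ⟨Nat.find hex, h1, ?_, Nat.find_spec hex⟩
    have := Nat.find_min hex (m := Nat.find hex - 1) (by omega)
    omega
  exact Nat.sInf_mem hne

lemma t₁_spec (hE : 4 ≤ baseScale n p) (hR : 2 ≤ ratio n p) (hD : baseScale n p < topScale p γ) :
    1 ≤ t₁ n p γ ∧ baseScale n p * ratio n p ^ (t₁ n p γ - 1) < topScale p γ ∧
      topScale p γ ≤ baseScale n p * ratio n p ^ t₁ n p γ := by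
  have hD' : (baseScale n p : ℝ) < topScale p γ := by exact_mod_cast hD
  have hE' : (4 : ℝ) ≤ baseScale n p := by exact_mod_cast hE
  have hex : ∃ t : ℕ, (topScale p γ : ℝ) ≤ baseScale n p * ratio n p ^ t := by
    obtain ⟨t, ht⟩ := pow_unbounded_of_one_lt (topScale p γ : ℝ) (by linarith : 1 < ratio n p)
    refine ⟨t, ht.le.trans ?_⟩
    exact le_mul_of_one_le_left (by positivity) (by linarith)
  have hne : {t : ℕ | 1 ≤ t ∧ baseScale n p * ratio n p ^ (t - 1) < topScale p γ ∧
      topScale p γ ≤ baseScale n p * ratio n p ^ t}.Nonempty := by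
    classical
    have h1 : 1 ≤ Nat.find hex := by
      rw [Nat.one_le_iff_ne_zero]
      intro h
      have := Nat.find_spec hex
      rw [h, pow_zero, mul_one] at this
      linarith
    refine ⟨Nat.find hex, h1, ?_, Nat.find_spec hex⟩
    have := Nat.find_min hex (m := Nat.find hex - 1) (by omega)
    exact not_le.1 this
  exact Nat.sInf_mem hne

lemma scale_zero : scale n p γ 0 = 1 := by simp [scale]

lemma scale_eq_three_pow {j : ℕ} (hj : j < t₀ n p) :
    scale n p γ j = 3 ^ j := by
  unfold scale
  split_ifs with h0
  · simp [h0]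
  · rfl

lemma scale_t₀ (hE : 4 ≤ baseScale n p) : scale n p γ (t₀ n p) = baseScale n p := by
  have := (t₀_spec hE).1
  unfold scale
  rw [if_neg (by omega), if_neg (lt_irrefl _), if_pos rfl]

lemma scale_of_lt {j : ℕ} (h0 : t₀ n p < j) (hj : j < numScales n p γ) :
    scale n p γ j = ⌊baseScale n p * ratio n p ^ (j - t₀ n p)⌋₊ := by
  unfold scale
  rw [if_neg (by omega), if_neg (by omega), if_neg (by omega), if_pos hj]

lemma scale_numScales (h1 : 1 ≤ t₁ n p γ) :
    scale n p γ (numScales n p γ) = topScale p γ := by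
  unfold scale
  have : numScales n p γ = t₀ n p + t₁ n p γ := rfl
  rw [if_neg (by omega), if_neg (by omega), if_neg (by omega), if_neg (by omega)]

/-- At the small scales the ratio of consecutive scales is at most three. -/
lemma scale_small (hE : 4 ≤ baseScale n p) {j : ℕ} (hj1 : 1 ≤ j) (hj : j ≤ t₀ n p) :
    scale n p γ j ≤ 3 * scale n p γ (j - 1) ∧ scale n p γ j ≤ baseScale n p ∧
      1 ≤ scale n p γ (j - 1) := by
  obtain ⟨h1, h2, h3⟩ := t₀_spec hE
  rw [scale_eq_three_pow (by omega : j - 1 < t₀ n p)]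
  have h4 : 3 * 3 ^ (j - 1) = 3 ^ j := by
    rw [← pow_succ', Nat.sub_add_cancel hj1]
  have h5 : 1 ≤ 3 ^ (j - 1) := Nat.one_le_pow _ _ (by norm_num)
  rw [h4]
  rcases hj.lt_or_eq with hlt | heq
  · rw [scale_eq_three_pow hlt]
    refine ⟨le_rfl, ?_, h5⟩
    exact (Nat.pow_le_pow_right (by norm_num) (by omega : j ≤ t₀ n p - 1)).trans h2.le
  · rw [heq, scale_t₀ hE]
    exact ⟨h3, le_rfl, heq ▸ h5⟩

/-- At the large scales the ratio of consecutive scales is at most `2 * ratio`. -/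
lemma scale_large (hE : 4 ≤ baseScale n p) (hR : 2 ≤ ratio n p)
    (hD : baseScale n p < topScale p γ) {j : ℕ} (hj0 : t₀ n p < j) (hj : j ≤ numScales n p γ) :
    (scale n p γ j : ℝ) ≤ 2 * ratio n p * scale n p γ (j - 1) ∧ scale n p γ j ≤ topScale p γ ∧
      baseScale n p ≤ scale n p γ (j - 1) := by
  obtain ⟨h1, h2, h3⟩ := t₁_spec hE hR hD
  have hs : numScales n p γ = t₀ n p + t₁ n p γ := rfl
  have hE' : (4 : ℝ) ≤ baseScale n p := by exact_mod_cast hE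
  have hR1 : 1 ≤ ratio n p := by linarith
  -- the exact value of the preceding scale
  have hprev : (baseScale n p : ℝ) * ratio n p ^ (j - 1 - t₀ n p) ≤ 2 * scale n p γ (j - 1) ∧
      baseScale n p ≤ scale n p γ (j - 1) := by
    rcases (Nat.le_sub_one_of_lt hj0).eq_or_lt with heq | hlt
    · rw [← heq, scale_t₀ hE]
      refine ⟨?_, le_rfl⟩
      simp only [Nat.sub_self, pow_zero, mul_one]
      linarith
    · rw [scale_of_lt hlt (by omega)]
      have hpow : (1 : ℝ) ≤ ratio n p ^ (j - 1 - t₀ n p) := one_le_pow₀ hR1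
      have hge : (baseScale n p : ℝ) ≤ baseScale n p * ratio n p ^ (j - 1 - t₀ n p) :=
        le_mul_of_one_le_right (by positivity) hpow
      refine ⟨?_, Nat.le_floor hge⟩
      have := Nat.lt_floor_add_one ((baseScale n p : ℝ) * ratio n p ^ (j - 1 - t₀ n p))
      linarith
  have hcur : (scale n p γ j : ℝ) ≤ baseScale n p * ratio n p ^ (j - t₀ n p) ∧
      scale n p γ j ≤ topScale p γ := by
    rcases hj.lt_or_eq with hlt | heq
    · rw [scale_of_lt hj0 hlt]
      have hfl := Nat.floor_le (a := (baseScale n p : ℝ) * ratio n p ^ (j - t₀ n p)) (by positivity)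
      refine ⟨hfl, ?_⟩
      have h4 : (baseScale n p : ℝ) * ratio n p ^ (j - t₀ n p) ≤
          baseScale n p * ratio n p ^ (t₁ n p γ - 1) := by
        exact mul_le_mul_of_nonneg_left (pow_le_pow_right₀ hR1 (by omega)) (by positivity)
      have h5 := (hfl.trans h4).trans h2.le
      exact_mod_cast h5
    · rw [heq, scale_numScales h1]
      refine ⟨?_, le_rfl⟩
      rw [hs, Nat.add_sub_cancel_left]
      exact h3
  refine ⟨?_, hcur.2, hprev.2⟩
  refine hcur.1.trans ?_
  have h6 : j - t₀ n p = (j - 1 - t₀ n p) + 1 := by omega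
  rw [h6, pow_succ, ← mul_assoc]
  calc _ ≤ 2 * (scale n p γ (j - 1) : ℝ) * ratio n p :=
        mul_le_mul_of_nonneg_right hprev.1 (by linarith)
    _ = _ := by ring

lemma scale_succ_le (hE : 4 ≤ baseScale n p) (hR : 2 ≤ ratio n p) {W : ℝ}
    (hW : ratio n p ≤ W) {i : ℕ} (hi : i + 1 < numScales n p γ) :
    (scale n p γ (i + 1) : ℝ) ≤ baseScale n p * W ^ (2 * i + 1) := by
  have hW1 : 1 ≤ W := by linarith
  have hpow : ∀ m : ℕ, (1 : ℝ) ≤ W ^ m := fun m => one_le_pow₀ hW1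
  rcases le_or_gt (i + 1) (t₀ n p) with h | h
  · have h1 : (scale n p γ (i + 1) : ℝ) ≤ baseScale n p := by
      exact_mod_cast (scale_small hE (by omega) h).2.1
    exact h1.trans (le_mul_of_one_le_right (by positivity) (hpow _))
  · rw [scale_of_lt h hi]
    refine (Nat.floor_le (by positivity)).trans ?_
    gcongr
    calc ratio n p ^ (i + 1 - t₀ n p) ≤ W ^ (i + 1 - t₀ n p) := by gcongr
      _ ≤ _ := pow_le_pow_right₀ hW1 (by omega)

end Scales

section Norm

variable {n : ℕ} {p γ C : ℝ}

lemma mem_steepLevel_iff {j : ℕ} {x : EuclideanSpace ℝ (Fin n)} :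
    x ∈ steepLevel n p γ C j ↔ (∀ i < j, 1 ≤ i → x ∉ steepLevel n p γ C i) ∧
      C * (p * n) * rearr x (scale n p γ j) < rearr x (scale n p γ (j - 1)) := by
  rw [steepLevel]
  simp only [Set.mem_ofPred_eq]
  exact and_congr_left fun _ => ⟨fun h i hi => h ⟨i, hi⟩, fun h i => h i i.isLt⟩

/-- As `x` lies in no earlier level, its rearrangement decays slowly up to the scale `j - 1`. -/
lemma rearr_scale_le {j : ℕ} {x : EuclideanSpace ℝ (Fin n)} (hx : x ∈ steepLevel n p γ C j)
    (hW : 0 ≤ C * (p * n)) {d i : ℕ} (hd : i + d + 1 = j) :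
    rearr x (scale n p γ i) ≤ (C * (p * n)) ^ d * rearr x (scale n p γ (j - 1)) := by
  induction d generalizing i with
  | zero =>
    have : j - 1 = i := by omega
    rw [this, pow_zero, one_mul]
  | succ d ih =>
    have h1 := ih (i := i + 1) (by omega)
    have hx1 := (mem_steepLevel_iff.1 hx).1
    have h2 : ¬ (C * (p * n) * rearr x (scale n p γ (i + 1)) < rearr x (scale n p γ i)) := by
      intro h
      refine hx1 (i + 1) (by omega) (by omega) (mem_steepLevel_iff.2 ⟨?_, by simpa using h⟩)
      exact fun i' hi' h1' => hx1 i' (by omega) h1'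
    rw [not_lt] at h2
    calc _ ≤ _ := h2
      _ ≤ C * (p * n) * ((C * (p * n)) ^ d * rearr x (scale n p γ (j - 1))) := by gcongr
      _ = _ := by ring

/-- The norm of a vector of `T_{1j}` in terms of its coordinate at the scale `j - 1`. -/
lemma norm_sq_le_of_mem_steepLevel {j : ℕ} {x : EuclideanSpace ℝ (Fin n)}
    (hx : x ∈ steepLevel n p γ C j) (hj1 : 1 ≤ j) (hj : j ≤ numScales n p γ)
    (hE : 4 ≤ baseScale n p) (hR : 2 ≤ ratio n p) (hW : ratio n p ≤ C * (p * n)) :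
    ‖x‖ ^ 2 ≤ rearr x (scale n p γ (j - 1)) ^ 2 *
      (n + baseScale n p * (C * (p * n)) ^ (2 * numScales n p γ) * (1 + Real.log n)) := by
  classical
  set W := C * (p * n) with hWdef
  set a := rearr x (scale n p γ (j - 1)) with ha
  set s := numScales n p γ with hs
  have hW1 : 1 ≤ W := by linarith
  have ha0 : 0 ≤ a := rearr_nonneg _ _
  set σ := Tuple.sort fun i => -|x i| with hσ
  have hpt : ∀ r : Fin n, |x (σ r)| ^ 2 ≤
      a ^ 2 * (1 + baseScale n p * W ^ (2 * s) * ((r : ℝ) + 1)⁻¹) := by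
    intro r
    have hy : rearr x (r + 1) = |x (σ r)| := by
      have : (r : ℕ) + 1 - 1 < n := by simp
      rw [rearr, dif_pos this]
      rfl
    have hnn : 0 ≤ baseScale n p * W ^ (2 * s) * ((r : ℝ) + 1)⁻¹ := by positivity
    rw [← hy]
    by_cases hr : scale n p γ (j - 1) ≤ r + 1
    · have h1 : rearr x (r + 1) ≤ a := rearr_anti x hr
      calc _ ≤ a ^ 2 := by
            have := rearr_nonneg x (r + 1)
            gcongr
        _ ≤ _ := le_mul_of_one_le_right (by positivity) (by linarith)
    · -- the block of scales that contains the rank `r + 1`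
      have hex : ∃ i, (r : ℕ) + 1 < scale n p γ i := ⟨j - 1, not_le.1 hr⟩
      have h1 := Nat.find_spec hex
      have h2 : Nat.find hex ≤ j - 1 := Nat.find_min' hex (not_le.1 hr)
      have h3 : Nat.find hex ≠ 0 := by
        intro h
        rw [h, scale_zero] at h1
        omega
      obtain ⟨i, hi⟩ := Nat.exists_eq_succ_of_ne_zero h3
      have h4 : scale n p γ i ≤ r + 1 := not_lt.1 (Nat.find_min hex (by omega))
      rw [hi] at h1 h2
      have h5 := (rearr_anti x h4).trans
        (rearr_scale_le hx (by linarith) (d := j - 1 - i) (by omega))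
      rw [← hWdef, ← ha] at h5
      have h6 : ((r : ℝ) + 1) ≤ baseScale n p * W ^ (2 * i + 1) := by
        refine le_trans ?_ (scale_succ_le hE hR hW (by omega : i + 1 < numScales n p γ))
        exact_mod_cast h1.le
      have h7 : (W ^ (j - 1 - i)) ^ 2 ≤ baseScale n p * W ^ (2 * s) * ((r : ℝ) + 1)⁻¹ := by
        rw [le_mul_inv_iff₀ (by positivity)]
        calc _ ≤ (W ^ (j - 1 - i)) ^ 2 * (baseScale n p * W ^ (2 * i + 1)) := by gcongr
          _ = baseScale n p * W ^ ((j - 1 - i) * 2 + (2 * i + 1)) := by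
              rw [← pow_mul, pow_add]; ring
          _ ≤ _ := by
              gcongr
              omega
      calc _ ≤ (W ^ (j - 1 - i) * a) ^ 2 := by
            have := rearr_nonneg x (r + 1)
            gcongr
        _ = a ^ 2 * (W ^ (j - 1 - i)) ^ 2 := by ring
        _ ≤ _ := by
            gcongr
            linarith
  have hharm : ∑ r : Fin n, ((r : ℝ) + 1)⁻¹ ≤ 1 + Real.log n := by
    have := harmonic_le_one_add_log n
    rw [harmonic] at this
    push_cast at this
    rwa [Finset.sum_range] at this
  rw [EuclideanSpace.norm_sq_eq, ← Equiv.sum_comp σ]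
  simp only [Real.norm_eq_abs]
  calc _ ≤ ∑ r : Fin n, a ^ 2 * (1 + baseScale n p * W ^ (2 * s) * ((r : ℝ) + 1)⁻¹) :=
        Finset.sum_le_sum fun r _ => hpt r
    _ = a ^ 2 * (n + baseScale n p * W ^ (2 * s) * ∑ r : Fin n, ((r : ℝ) + 1)⁻¹) := by
        rw [← Finset.mul_sum, Finset.sum_add_distrib, ← Finset.mul_sum]
        simp
    _ ≤ _ := by gcongr

end Norm

/-! ### Union bounds over column sets -/

/-- The union bound over the column sets of size `m`, with the weight `c = n / (m p n) ^ 2` for each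
unit of excess, the largest for which the row factors stay bounded. -/
lemma law_exists_excess_le {n m : ℕ} (p : unitInterval) (hn : 0 < n) (hm : 1 ≤ m)
    (hu : 1 ≤ (p : ℝ) * n) (hmu : (m * ((p : ℝ) * n)) ^ 2 ≤ n) :
    (law n p).real {ω | ∃ S : Finset (Fin n), S.card = m ∧ 3 * m < excess ω S} ≤
      Real.exp 2 * ((m * ((p : ℝ) * n)) ^ 6 / (n : ℝ) ^ 2) ^ m := by
  have hn0 : (0 : ℝ) < n := by exact_mod_cast hn
  have hm1 : (1 : ℝ) ≤ m := by exact_mod_cast hm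
  set u := (p : ℝ) * n with hudef
  have hu0 : 0 < u := by linarith
  set c : ℝ := n / (m * u) ^ 2 with hc
  have hmu1 : 1 ≤ m * u := one_le_mul_of_one_le_of_one_le hm1 hu
  have hc1 : 1 ≤ c := by rw [hc, one_le_div (by positivity)]; exact hmu
  have hc0 : 0 < c := by linarith
  have hcard : (Finset.univ.powersetCard m : Finset (Finset (Fin n))).card ≤ n ^ m := by
    rw [Finset.card_powersetCard, Finset.card_univ, Fintype.card_fin]
    exact Nat.choose_le_pow n m
  refine (law_union_le (p := p) (Finset.univ.powersetCard m : Finset (Finset (Fin n)))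
    (fun S => {ω | 3 * S.card < excess ω S}) _ (c := c⁻¹ ^ (3 * m) * Real.exp 2) ?_ ?_).trans ?_
  · rintro ω ⟨S, hS, hω⟩
    refine ⟨S, by simp [hS], ?_⟩
    change 3 * S.card < excess ω S
    rwa [hS]
  · intro S hS
    have hSm : S.card = m := (Finset.mem_powersetCard.1 hS).2
    have hpu : (p : ℝ) = u / n := by rw [hudef]; field_simp
    have h1 : S.card * (p : ℝ) * c ≤ 1 := by
      rw [hSm, hpu, hc]
      have : (m : ℝ) * (u / n) * (n / (m * u) ^ 2) = (m * u)⁻¹ := by field_simp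
      rw [this]
      exact inv_le_one_of_one_le₀ hmu1
    refine (law_excess_le p S hc1 h1).trans ?_
    rw [hSm]
    gcongr
    have h2 : n * ((m * (p : ℝ)) ^ 2 * (1 + c)) = (m * u) ^ 2 / n + 1 := by
      rw [hpu, hc]; field_simp
    rw [h2]
    have : (m * u) ^ 2 / n ≤ 1 := (div_le_one hn0).2 hmu
    linarith
  · have h3 : c⁻¹ ^ (3 * m) * (n : ℝ) ^ m = ((m * u) ^ 6 / (n : ℝ) ^ 2) ^ m := by
      rw [pow_mul, ← mul_pow, hc]
      congr 1
      field_simp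
    calc _ ≤ ((n ^ m : ℕ) : ℝ) * (c⁻¹ ^ (3 * m) * Real.exp 2) := by gcongr
      _ = Real.exp 2 * (c⁻¹ ^ (3 * m) * (n : ℝ) ^ m) := by push_cast; ring
      _ = _ := by rw [h3]

/-- If `h ≤ √n`, then `h p ≤ u / √n` is tiny. -/
lemma mul_le_of_log_le_half {n h p u l : ℝ} (hn0 : 0 < n) (hh0 : 0 < h) (hu : u = p * n)
    (hl : l = Real.log u) (hu0 : 0 < u) (hh : Real.log h ≤ Real.log n / 2) (hl8 : 8 ≤ l)
    (hlL : 8 * l ≤ Real.log n) : h * p ≤ 1 / (8 * l ^ 2) := by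
  set L := Real.log n with hL
  have h1 : h ≤ Real.exp (L / 2) := by
    rw [← Real.log_le_iff_le_exp hh0]; exact hh
  have h2 : p = u * Real.exp (-L) := by
    rw [hu, hL, Real.exp_neg, Real.exp_log hn0]; field_simp
  have h3 : u = Real.exp l := by rw [hl, Real.exp_log hu0]
  have h4 : l ^ 2 ≤ Real.exp (2 * l) := by
    have := Real.add_one_le_exp l
    rw [two_mul, Real.exp_add]
    nlinarith
  have h5 : (8 : ℝ) ≤ Real.exp l := by
    have := Real.add_one_le_exp l
    linarith
  rw [le_div_iff₀ (by positivity)]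
  calc h * p * (8 * l ^ 2) ≤
        Real.exp (L / 2) * (Real.exp l * Real.exp (-L)) * (Real.exp l * Real.exp (2 * l)) := by
        rw [h2, ← h3]
        have : u ≤ Real.exp l := h3.le
        gcongr
        rw [h3]; exact h5
    _ = Real.exp (L / 2 + (l + -L) + (l + 2 * l)) := by
        rw [Real.exp_add, Real.exp_add, Real.exp_add, Real.exp_add]
    _ ≤ 1 := by
        rw [Real.exp_le_one_iff]
        linarith

/-- The parameters of the union bound `law_exists_blocked_le` at the large scales. Here `u = p n`,
`l = log u`, and `m ≤ 2 (u / l ^ 3) h`. When `h ≤ √n`, the entropy of `J` leaves room for a deviation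
of relative size `1 / l ^ 2` only, so that `T` is about `h u / l ^ (5 / 2)`; when `h ≥ √n`, a constant
proportion of the expected number of rows is available. -/
lemma exists_union_params {n h m k : ℕ} {p u l : ℝ} (hn : 0 < n) (hp : 0 < p) (hu : u = p * n)
    (hl : l = Real.log u) (hLu : Real.log n ≤ u) (huL : u ≤ 2 * Real.log n) (hl400 : 400 ≤ l)
    (hlu : l ^ 4 ≤ u) (hexp : Real.exp (-(√l / 8)) ≤ 1 / (8 * l ^ 2))
    (hh4u : 4 * u ≤ h) (hhk : (k : ℝ) ≤ h) (hhE : u / l ^ 2 ≤ Real.log h) (hhm : h ≤ m)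
    (hmR : (m : ℝ) ≤ 2 * (u / l ^ 3) * h) (hmp : m * p ≤ 1 / 100) :
    ∃ θ T y : ℝ, 0 ≤ θ ∧ Real.log 2 ≤ y ∧ m * p ≤ Real.exp (-y) ∧
      h * (1 + Real.log n - Real.log h) + θ * T -
          h * (p * n) * (1 - h * p) * (1 - Real.exp (-θ)) ≤ -(3 * Real.log n) ∧
      m * (1 + Real.log n - Real.log m + Real.log 2) + (k : ℝ) / 8 * y + T * (Real.log 2 - y) ≤
        -(3 * Real.log n) := by
  set L := Real.log n with hL
  have hn0 : (0 : ℝ) < n := by exact_mod_cast hn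
  have hl0 : 0 < l := by linarith
  have hu0 : 0 < u := by rw [hu]; positivity
  have hl2 : 1000 ≤ l ^ 2 := by
    calc (1000 : ℝ) ≤ 400 ^ 2 := by norm_num
      _ ≤ l ^ 2 := by gcongr
  have hl3 : 1000 * l ≤ l ^ 3 := by
    rw [pow_succ]
    gcongr
  have hl4 : 1000 * l ^ 2 ≤ l ^ 4 := by
    have : l ^ 4 = l ^ 2 * l ^ 2 := by ring
    rw [this]
    gcongr
  have hu1 : 400 * l ≤ u := by
    have : 400 * l ≤ l ^ 2 := by
      rw [sq]
      gcongr
    linarith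
  have hh0 : (0 : ℝ) < h := by linarith
  have hhm' : (h : ℝ) ≤ m := by exact_mod_cast hhm
  have hm0 : (0 : ℝ) < m := by linarith
  have hmp0 : 0 < m * p := by positivity
  have hhp : h * p ≤ m * p := by gcongr
  set y := -Real.log (m * p) with hy
  have hyexp : Real.exp (-y) = m * p := by rw [hy, neg_neg, Real.exp_log hmp0]
  have hlog2 : Real.log 2 ≤ 1 := by
    have := Real.log_two_lt_d9; linarith
  have hy4 : 4 ≤ y := by
    rw [hy, le_neg]
    have : Real.log (m * p) ≤ Real.log (Real.exp (-4)) := by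
      refine Real.log_le_log hmp0 (hmp.trans ?_)
      rw [Real.exp_neg, one_div]
      refine inv_anti₀ (Real.exp_pos _) ?_
      have h1 := Real.exp_one_lt_d9
      have h2 : Real.exp 4 = Real.exp 1 ^ 4 := by rw [← Real.exp_nat_mul]; norm_num
      rw [h2]
      calc Real.exp 1 ^ 4 ≤ 3 ^ 4 := by gcongr; linarith
        _ ≤ 100 := by norm_num
    rwa [Real.log_exp] at this
  -- `y` in terms of the logarithms
  have hyL : y = L - Real.log m - l := by
    have : p = u / n := by rw [hu]; field_simp
    rw [hy, this, Real.log_mul hm0.ne' (by positivity), Real.log_div hu0.ne' hn0.ne', ← hl, ← hL]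
    ring
  have hmu : 4 * u ≤ m := hh4u.trans hhm'
  have hmk : (k : ℝ) ≤ m := hhk.trans hhm'
  -- it remains to compare the entropy with `T`
  have hfin : ∀ T : ℝ, 0 ≤ T → m * (2 + y + l) + m / 8 * y - T * (y / 2) ≤ -(m * y) →
      m * (1 + L - Real.log m + Real.log 2) + (k : ℝ) / 8 * y + T * (Real.log 2 - y) ≤
        -(3 * L) := by
    intro T hT hTm
    have h1 : m * (1 + L - Real.log m + Real.log 2) ≤ m * (2 + y + l) :=
      mul_le_mul_of_nonneg_left (by linarith) hm0.le
    have h2 : (k : ℝ) / 8 * y ≤ m / 8 * y := by gcongr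
    have h3 : T * (Real.log 2 - y) ≤ T * (-(y / 2)) :=
      mul_le_mul_of_nonneg_left (by linarith) hT
    have h4 : m * 1 ≤ m * y := mul_le_mul_of_nonneg_left (by linarith) hm0.le
    linarith
  -- the lower bound for `h` in terms of `m`
  have hhge : m * l ^ 3 ≤ 2 * (h * u) := by
    have h1 : (2 * (u / l ^ 3) * h) * l ^ 3 = 2 * (h * u) := by field_simp
    rw [← h1]
    gcongr
  rcases le_or_gt (L / 2) (Real.log h) with hlarge | hsmall
  · refine ⟨Real.log 16, h * u / 64, y, Real.log_nonneg (by norm_num), by linarith, hyexp.ge,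
      ?_, hfin _ (by positivity) ?_⟩
    · have h16 : Real.log 16 ≤ 3 := by
        have : Real.log 16 = 4 * Real.log 2 := by
          rw [← Real.log_rpow (by norm_num)]; norm_num
        have := Real.log_two_lt_d9
        linarith
      have he : Real.exp (-Real.log 16) = 1 / 16 := by
        rw [Real.exp_neg, Real.exp_log (by norm_num)]; norm_num
      rw [he, ← hu]
      have h1 : h * (1 + L - Real.log h) ≤ h * (1 + L / 2) :=
        mul_le_mul_of_nonneg_left (by linarith) hh0.le
      have h2 : Real.log 16 * (h * u / 64) ≤ 3 * (h * u / 64) := by gcongr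
      have h3 : h * u * (15 / 16) * (1 - 1 / 16) ≤ h * u * (1 - h * p) * (1 - 1 / 16) := by
        gcongr
        linarith
      have h4 : h * L ≤ h * u := by gcongr
      have h5 : h * 200 ≤ h * L := by gcongr; linarith
      linarith
    · have h1 : m * l ^ 3 / 128 * (y / 2) ≤ h * u / 64 * (y / 2) := by
        gcongr ?_ * _
        linarith
      have h2 : 0 < m * y := by positivity
      have h3 : m * y * (1000 * l) ≤ m * y * l ^ 3 := by gcongr
      have h4 : m * l * 4 ≤ m * l * y := by gcongr
      have h5 : m * 4 ≤ m * y := by gcongr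
      have h6 : m * y * 400 ≤ m * y * l := by gcongr
      linarith
  · have hsq : √l * √l = l := Real.mul_self_sqrt hl0.le
    have hsq20 : 20 ≤ √l := by
      rw [Real.le_sqrt (by norm_num) hl0.le]; linarith
    have hs0 : 0 < √l := by linarith
    refine ⟨√l / 8, h * u / (l ^ 2 * √l), y, by positivity, by linarith, hyexp.ge, ?_,
      hfin _ (by positivity) ?_⟩
    · set d : ℝ := 1 / (8 * l ^ 2) with hd
      have hd0 : 0 < d := by positivity
      have hud : u / l ^ 2 = 8 * (u * d) := by rw [hd]; field_simp
      have hθT : √l / 8 * (h * u / (l ^ 2 * √l)) = h * (u * d) := by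
        rw [hd]; field_simp
      have hhpd : h * p ≤ d := mul_le_of_log_le_half hn0 hh0 hu hl hu0 hsmall.le (by linarith)
        (by linarith)
      rw [hθT, ← hu]
      have h1 : h * u * (1 - 2 * d) ≤ h * u * (1 - h * p) * (1 - Real.exp (-(√l / 8))) := by
        rw [mul_assoc (h * u)]
        gcongr
        have hd1 : d ≤ 1 := by
          rw [hd, div_le_one (by positivity)]
          linarith
        have h2 : (1 - d) * (1 - d) ≤ (1 - h * p) * (1 - Real.exp (-(√l / 8))) :=
          mul_le_mul (by linarith) (by linarith) (by linarith) (by linarith)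
        have h3 : 0 ≤ d * d := by positivity
        linarith
      have h2 : h * (1 + L - Real.log h) ≤ h * (1 + u - 8 * (u * d)) :=
        mul_le_mul_of_nonneg_left (by linarith) hh0.le
      have h3 : 2 ≤ 5 * (u * d) := by
        have : l ^ 2 * 16 ≤ u := by linarith
        have : 16 ≤ u / l ^ 2 := by rw [le_div_iff₀ (by positivity)]; linarith
        linarith
      have h4 : h * 2 ≤ h * (5 * (u * d)) := by gcongr
      linarith
    · have hTm : m * √l / 2 ≤ h * u / (l ^ 2 * √l) := by
        rw [le_div_iff₀ (by positivity)]
        calc m * √l / 2 * (l ^ 2 * √l) = m * l ^ 2 * (√l * √l) / 2 := by ring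
          _ = m * l ^ 3 / 2 := by rw [hsq]; ring
          _ ≤ _ := by linarith
      have hyl : l ≤ y := by
        have h1 : Real.log m ≤ l + Real.log h := by
          rw [hl, ← Real.log_mul hu0.ne' hh0.ne']
          refine Real.log_le_log hm0 (hmR.trans ?_)
          gcongr
          have : 2 * (u / l ^ 3) = u * (2 / l ^ 3) := by ring
          rw [this]
          refine mul_le_of_le_one_right hu0.le ?_
          rw [div_le_one (by positivity)]
          linarith
        linarith
      have h1 : m * √l / 2 * (y / 2) ≤ h * u / (l ^ 2 * √l) * (y / 2) := by gcongr
      have h2 : m * y * 20 ≤ m * y * √l := by gcongr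
      have h3 : m * l ≤ m * y := by gcongr
      have h5 : m * 4 ≤ m * y := by gcongr
      linarith

/-! ### The good event -/

/-- The numerical conditions on `n`, `p` and `k` that the argument uses; for fixed `k` they hold for
all large `n`, uniformly in the admissible `p`. -/
structure Regular (k n : ℕ) (p : ℝ) : Prop where
  n_pos : 0 < n
  p_pos : 0 < p
  p_le : p ≤ 1 / 1000
  log_le : Real.log n ≤ p * n
  le_log : p * n ≤ 2 * Real.log n
  log_ge : 400 ≤ Real.log (p * n)
  log_pow_le : Real.log (p * n) ^ 4 ≤ p * n
  exp_le : Real.exp (-(√(Real.log (p * n)) / 8)) ≤ 1 / (8 * Real.log (p * n) ^ 2)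
  le_baseScale : 4 * (p * n) ≤ baseScale n p
  k_le_baseScale : k ≤ baseScale n p
  baseScale_small : Real.exp 2 * (baseScale n p : ℝ) ^ 7 * (p * n) ^ 6 ≤ n
  baseScale_lt : baseScale n p < topScale p 1000
  poly_le : 4 + 2 * Real.exp 3 * (p * n) ^ (2 * k + 4) ≤ Real.log n ^ (5 * k)

lemma baseScale_le_exp {n : ℕ} {p : ℝ} (h : 0 ≤ p * n) :
    (baseScale n p : ℝ) ≤ Real.exp (1 + p * n / Real.log (p * n) ^ 2) := by
  have h1 : (baseScale n p : ℝ) ≤ Real.exp (p * n / Real.log (p * n) ^ 2) + 1 :=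
    (Nat.ceil_lt_add_one (Real.exp_pos _).le).le
  have h2 : 1 ≤ Real.exp (p * n / Real.log (p * n) ^ 2) :=
    Real.one_le_exp (div_nonneg h (sq_nonneg _))
  have h3 : 2 ≤ Real.exp 1 := by
    have := Real.exp_one_gt_d9; linarith
  rw [Real.exp_add]
  nlinarith

namespace Regular

variable {k n : ℕ} {p : ℝ}

lemma four_hundred_le (h : Regular k n p) : 400 ≤ p * n := by
  have h1 := h.log_ge
  have h2 := h.log_pow_le
  have h3 : Real.log (p * n) ≤ Real.log (p * n) ^ 4 := le_self_pow₀ (by linarith) (by norm_num)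
  linarith

lemma four_le_baseScale (h : Regular k n p) : 4 ≤ baseScale n p := by
  have h1 := h.four_hundred_le
  have h2 := h.le_baseScale
  have : (4 : ℝ) ≤ baseScale n p := by linarith
  exact_mod_cast this

lemma two_le_ratio (h : Regular k n p) : 2 ≤ ratio n p := by
  have h1 := h.log_ge
  have h2 := h.log_pow_le
  rw [ratio, le_div_iff₀ (by positivity)]
  have h3 : 2 * Real.log (p * n) ^ 3 ≤ Real.log (p * n) * Real.log (p * n) ^ 3 := by
    gcongr; linarith
  have h4 : Real.log (p * n) * Real.log (p * n) ^ 3 = Real.log (p * n) ^ 4 := by ring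
  linarith

lemma div_le_log_baseScale (h : Regular k n p) :
    p * n / Real.log (p * n) ^ 2 ≤ Real.log (baseScale n p) := by
  rw [Real.le_log_iff_exp_le (by exact_mod_cast lt_of_lt_of_le (by norm_num) h.four_le_baseScale)]
  exact Nat.le_ceil _

lemma topScale_le (h : Regular k n p) : topScale p 1000 ≤ n := by
  refine Nat.ceil_le.2 ?_
  have hp0 := h.p_pos
  rw [div_le_iff₀ (by positivity)]
  linarith [h.four_hundred_le]

lemma exp_neg_le (h : Regular k n p) : Real.exp (-(p * n)) ≤ (n : ℝ)⁻¹ := by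
  have hn0 : (0 : ℝ) < n := by exact_mod_cast h.n_pos
  rw [Real.exp_neg]
  gcongr
  rw [← Real.log_le_iff_le_exp hn0]
  exact h.log_le

end Regular

/-- The event on which the argument is deterministic: no row is long, the low columns do not clash,
every set of at most `baseScale n p` columns has small excess, and for every admissible pair
`J ⊆ J'` of large column sets many rows meet `J` once and the rest of `J'` never. -/
def goodEvent (n : ℕ) (p γ : ℝ) (k : ℕ) : Set (Sample n) :=
  {ω | (∀ i, (hits (row ω i) Finset.univ : ℝ) ≤ 5 * (p * n)) ∧ ¬ lowClash ω k ∧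
    (∀ S : Finset (Fin n), 1 ≤ S.card → S.card ≤ baseScale n p → excess ω S ≤ 3 * S.card) ∧
    ∀ J J' : Finset (Fin n), J ⊆ J' → baseScale n p ≤ J.card →
      (J'.card : ℝ) ≤ 2 * ratio n p * J.card → J'.card ≤ topScale p γ →
      (k : ℝ) / 8 < (singleRows ω J (J' \ J)).card}

/-- The union over all sizes up to `E = baseScale n p`; the smallness of `E` against `n` makes up for
the entropy. -/
lemma law_exists_excess_small {k n : ℕ} {p : unitInterval} (hr : Regular k n p) :
    (law n p).real {ω | ∃ S : Finset (Fin n), 1 ≤ S.card ∧ S.card ≤ baseScale n p ∧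
      3 * S.card < excess ω S} ≤ (n : ℝ)⁻¹ := by
  have hn0 : (0 : ℝ) < n := by exact_mod_cast hr.n_pos
  have hn1 : (1 : ℝ) ≤ n := by exact_mod_cast hr.n_pos
  have hu := hr.four_hundred_le
  have hsm := hr.baseScale_small
  set u := (p : ℝ) * n with hudef
  set E := baseScale n p with hE
  have hE4 : (4 : ℝ) ≤ E := by exact_mod_cast hr.four_le_baseScale
  have he2 : 1 ≤ Real.exp 2 := Real.one_le_exp (by norm_num)
  have hu1 : 1 ≤ u := by linarith
  have hE1 : (1 : ℝ) ≤ E := by linarith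
  have hEu : (E * u) ^ 6 ≤ n := by
    refine le_trans ?_ hsm
    rw [mul_pow]
    gcongr ?_ * _
    calc (E : ℝ) ^ 6 ≤ E ^ 7 := pow_le_pow_right₀ hE1 (by norm_num)
      _ ≤ _ := le_mul_of_one_le_left (by positivity) he2
  have hz : (E * u) ^ 6 / (n : ℝ) ^ 2 ≤ 1 := by
    rw [div_le_one (by positivity)]
    exact hEu.trans (le_self_pow₀ hn1 (by norm_num))
  refine (law_union_le (p := p) (Finset.Icc 1 E)
    (fun m => {ω | ∃ S : Finset (Fin n), S.card = m ∧ 3 * m < excess ω S}) _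
    (c := Real.exp 2 * ((E * u) ^ 6 / (n : ℝ) ^ 2)) ?_ ?_).trans ?_
  · rintro ω ⟨S, h1, h2, h3⟩
    exact ⟨S.card, Finset.mem_Icc.2 ⟨h1, h2⟩, S, rfl, h3⟩
  · intro m hm
    obtain ⟨hm1, hmE⟩ := Finset.mem_Icc.1 hm
    have hmE' : (m : ℝ) ≤ E := by exact_mod_cast hmE
    have hm1' : (1 : ℝ) ≤ m := by exact_mod_cast hm1
    have hmu1 : 1 ≤ E * u := one_le_mul_of_one_le_of_one_le hE1 hu1
    refine (law_exists_excess_le p hr.n_pos hm1 hu1 ?_).trans ?_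
    · rw [← hudef]
      calc (m * u) ^ 2 ≤ (E * u) ^ 2 := by gcongr
        _ ≤ (E * u) ^ 6 := pow_le_pow_right₀ hmu1 (by norm_num)
        _ ≤ n := hEu
    · rw [← hudef]
      gcongr
      have h1 : (m * u) ^ 6 / (n : ℝ) ^ 2 ≤ (E * u) ^ 6 / (n : ℝ) ^ 2 := by gcongr
      refine (pow_le_of_le_one (by positivity) (h1.trans hz) (by omega)).trans h1
  · rw [Nat.card_Icc, Nat.add_sub_cancel]
    have h1 : (E : ℝ) * (Real.exp 2 * ((E * u) ^ 6 / (n : ℝ) ^ 2)) =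
        (Real.exp 2 * (E : ℝ) ^ 7 * u ^ 6) / (n : ℝ) ^ 2 := by ring
    rw [h1]
    calc _ ≤ (n : ℝ) / (n : ℝ) ^ 2 := by gcongr
      _ = (n : ℝ)⁻¹ := by field_simp

/-- The union over all pairs of sizes. The sizes are at most `n`, and each pair costs
`2 / n ^ 3`. -/
lemma law_exists_blocked_small {k n : ℕ} {p : unitInterval} (hr : Regular k n p) :
    (law n p).real {ω | ∃ J J' : Finset (Fin n), J ⊆ J' ∧ baseScale n p ≤ J.card ∧
      (J'.card : ℝ) ≤ 2 * ratio n p * J.card ∧ J'.card ≤ topScale p 1000 ∧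
      ((singleRows ω J (J' \ J)).card : ℝ) ≤ k / 8} ≤ 2 * (n : ℝ)⁻¹ := by
  have hn0 : (0 : ℝ) < n := by exact_mod_cast hr.n_pos
  have hp0 := hr.p_pos
  have hE4 := hr.four_le_baseScale
  set Q : Finset (ℕ × ℕ) := (Finset.Icc 1 n ×ˢ Finset.Icc 1 n).filter fun q =>
    q.1 ≤ q.2 ∧ baseScale n p ≤ q.1 ∧ (q.2 : ℝ) ≤ 2 * ratio n p * q.1 ∧ q.2 ≤ topScale p 1000
  have hQ : (Q.card : ℝ) ≤ (n : ℝ) ^ 2 := by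
    have : Q.card ≤ n ^ 2 := (Finset.card_filter_le _ _).trans (by simp [sq])
    exact_mod_cast this
  refine (law_union_le (p := p) Q
    (fun q => {ω | ∃ J J' : Finset (Fin n), J ⊆ J' ∧ J.card = q.1 ∧ J'.card = q.2 ∧
        ((singleRows ω J (J' \ J)).card : ℝ) ≤ k / 8}) _
    (c := 2 * ((n : ℝ)⁻¹) ^ 3) ?_ ?_).trans ?_
  · rintro ω ⟨J, J', h1, h2, h3, h4, h5⟩
    refine ⟨(J.card, J'.card), ?_, J, J', h1, rfl, rfl, h5⟩
    have h6 := Finset.card_le_card h1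
    have h7 : J'.card ≤ n := by simpa using Finset.card_le_univ J'
    simp only [Q, Finset.mem_filter, Finset.mem_product, Finset.mem_Icc]
    exact ⟨⟨⟨by omega, by omega⟩, by omega, by omega⟩, h6, h2, h3, h4⟩
  · rintro ⟨h, m⟩ hq
    simp only [Q, Finset.mem_filter, Finset.mem_product, Finset.mem_Icc] at hq
    obtain ⟨⟨⟨hh1, -⟩, hm1, -⟩, hhm, hEh, hmR, hmD⟩ := hq
    have hEh' : (baseScale n p : ℝ) ≤ h := by exact_mod_cast hEh
    have hE0 : (0 : ℝ) < baseScale n p := by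
      exact_mod_cast lt_of_lt_of_le (by norm_num) hE4
    have hmp : (m : ℝ) * p ≤ 1 / 100 := by
      have h1 : (m : ℝ) ≤ 1 / (1000 * p) + 1 := by
        have hmD' : (m : ℝ) ≤ (topScale (p : ℝ) 1000 : ℝ) := by exact_mod_cast hmD
        exact hmD'.trans (Nat.ceil_lt_add_one (by positivity)).le
      calc (m : ℝ) * p ≤ (1 / (1000 * p) + 1) * p := by gcongr
        _ = 1 / 1000 + p := by field_simp
        _ ≤ _ := by linarith [hr.p_le]
    obtain ⟨θ, T, y, hθ, hy, hmy, h1, h2⟩ := exists_union_params (k := k) (h := h) (m := m) hr.n_pos hp0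
      rfl rfl hr.log_le hr.le_log hr.log_ge hr.log_pow_le hr.exp_le
      (hr.le_baseScale.trans hEh') (le_trans (by exact_mod_cast hr.k_le_baseScale) hEh')
      (hr.div_le_log_baseScale.trans (Real.log_le_log hE0 hEh')) hhm hmR hmp
    refine (law_exists_blocked_le p hh1 hm1 hr.n_pos (κ := k / 8) (T := T) hθ hy hmy).trans ?_
    have h3 : Real.exp (-(3 * Real.log n)) = ((n : ℝ)⁻¹) ^ 3 := by
      have : -(3 * Real.log n) = (3 : ℕ) * (-Real.log n) := by push_cast; ring
      rw [this, Real.exp_nat_mul, Real.exp_neg, Real.exp_log hn0]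
    rw [two_mul, ← h3]
    exact add_le_add (Real.exp_le_exp.2 h1) (Real.exp_le_exp.2 h2)
  · calc (Q.card : ℝ) * (2 * ((n : ℝ)⁻¹) ^ 3) ≤ (n : ℝ) ^ 2 * (2 * ((n : ℝ)⁻¹) ^ 3) := by gcongr
      _ = 2 * (n : ℝ)⁻¹ := by field_simp

lemma law_compl_goodEvent_le {k n : ℕ} {p : unitInterval} (hr : Regular k n p) :
    (law n p).real (goodEvent n p 1000 k)ᶜ ≤ Real.log n ^ (5 * k) * (n : ℝ)⁻¹ := by
  have hn0 : (0 : ℝ) < n := by exact_mod_cast hr.n_pos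
  have hn1 : (1 : ℝ) ≤ n := by exact_mod_cast hr.n_pos
  set A : Set (Sample n) := {ω | ∃ i, 5 * ((p : ℝ) * n) < hits (row ω i) Finset.univ}
  set B : Set (Sample n) := {ω | lowClash ω k}
  set C : Set (Sample n) := {ω | ∃ S : Finset (Fin n), 1 ≤ S.card ∧ S.card ≤ baseScale n p ∧
      3 * S.card < excess ω S}
  set D : Set (Sample n) := {ω | ∃ J J' : Finset (Fin n), J ⊆ J' ∧ baseScale n p ≤ J.card ∧
      (J'.card : ℝ) ≤ 2 * ratio n p * J.card ∧ J'.card ≤ topScale p 1000 ∧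
      ((singleRows ω J (J' \ J)).card : ℝ) ≤ k / 8}
  have hA : (law n p).real A ≤ (n : ℝ)⁻¹ := by
    refine (law_long_row_le n p).trans ?_
    have h1 : Real.exp (-3 * ((p : ℝ) * n)) ≤ ((n : ℝ)⁻¹) ^ 3 := by
      have : -3 * ((p : ℝ) * n) = (3 : ℕ) * (-((p : ℝ) * n)) := by push_cast; ring
      rw [this, Real.exp_nat_mul]
      have := hr.exp_neg_le
      gcongr
    calc (n : ℝ) * Real.exp (-3 * ((p : ℝ) * n)) ≤ n * ((n : ℝ)⁻¹) ^ 3 := by gcongr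
      _ = (n : ℝ)⁻¹ * (n : ℝ)⁻¹ := by field_simp
      _ ≤ (n : ℝ)⁻¹ := mul_le_of_le_one_right (by positivity) (inv_le_one_of_one_le₀ hn1)
  have hB : (law n p).real B ≤ 2 * Real.exp 3 * ((p : ℝ) * n) ^ (2 * k + 4) * (n : ℝ)⁻¹ :=
    law_lowClash_le p k hr.n_pos (by linarith [hr.four_hundred_le]) hr.log_le
      (by linarith [hr.p_le])
  have hC : (law n p).real C ≤ (n : ℝ)⁻¹ := law_exists_excess_small hr
  have hD : (law n p).real D ≤ 2 * (n : ℝ)⁻¹ := law_exists_blocked_small hr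
  have hsub : (goodEvent n p 1000 k)ᶜ ⊆ (A ∪ B) ∪ (C ∪ D) := by
    intro ω hω
    by_contra hnot
    simp only [Set.mem_union, not_or] at hnot
    obtain ⟨⟨h1, h2⟩, h3, h4⟩ := hnot
    refine hω ⟨fun i => ?_, h2, fun S hS1 hS2 => ?_, fun J J' hJ h5 h6 h7 => ?_⟩
    · by_contra h; exact h1 ⟨i, not_le.1 h⟩
    · by_contra h; exact h3 ⟨S, hS1, hS2, not_le.1 h⟩
    · by_contra h; exact h4 ⟨J, J', hJ, h5, h6, h7, not_lt.1 h⟩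
  have h1 : (law n p).real (goodEvent n p 1000 k)ᶜ ≤ ((law n p).real A + (law n p).real B) +
      ((law n p).real C + (law n p).real D) :=
    (measureReal_mono hsub (measure_ne_top _ _)).trans ((measureReal_union_le _ _).trans
      (add_le_add (measureReal_union_le _ _) (measureReal_union_le _ _)))
  calc _ ≤ (4 + 2 * Real.exp 3 * ((p : ℝ) * n) ^ (2 * k + 4)) * (n : ℝ)⁻¹ := by linarith
    _ ≤ _ := by
        have := hr.poly_le
        gcongr

/-- On the good event, a vector of `T_1` gives entries of `A x` of the size of its coordinate at the
scale preceding the steep drop. -/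
lemma large_rows_of_goodEvent {k n : ℕ} {p : unitInterval} (hr : Regular k n p) (hk : 1000 ≤ k)
    {ω : Sample n} (hω : ω ∈ goodEvent n p 1000 k) {j : ℕ} (hj1 : 1 ≤ j)
    (hj : j ≤ numScales n p 1000) {x : EuclideanSpace ℝ (Fin n)}
    (hx : x ∈ steepLevel n p 1000 1000 j)
    (hzero : ∀ j ∈ lowColumns (toMatrix ω) 0, x j = 0) :
    (∃ i ∈ lowRows (toMatrix ω) k,
        rearr x (scale n p 1000 (j - 1)) / 100 ≤ |(toMatrix ω).mulVec x.ofLp i|) ∨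
      (k : ℝ) / 8 < (Finset.univ.filter fun i : Fin n =>
        rearr x (scale n p 1000 (j - 1)) / 100 ≤ |(toMatrix ω).mulVec x.ofLp i|).card := by
  obtain ⟨hrow, hclash, hex, hblk⟩ := hω
  have hE4 := hr.four_le_baseScale
  have hlt := (mem_steepLevel_iff.1 hx).2
  have hu := hr.four_hundred_le
  set h := scale n p 1000 (j - 1) with hh
  set m := scale n p 1000 j with hm
  set a := rearr x h with ha
  set τ := rearr x m with hτ
  have hτ0 : 0 ≤ τ := rearr_nonneg _ _
  have hτa : τ ≤ 1000 * (p * n) * τ := by nlinarith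
  have ha0 : 0 < a := by linarith
  have hMτ : 5 * ((p : ℝ) * n) * τ ≤ a / 100 := by linarith
  have hhm : h < m := by
    by_contra hmh
    have := rearr_anti x (not_lt.1 hmh)
    linarith
  -- all scales are at most `n`
  have hDn : topScale (p : ℝ) 1000 ≤ n := hr.topScale_le
  have hEn : baseScale n (p : ℝ) ≤ n := hr.baseScale_lt.le.trans hDn
  have hmn : m ≤ n := by
    rcases le_or_gt j (t₀ n p) with hjt | hjt
    · exact (scale_small hE4 hj1 hjt).2.1.trans hEn
    · exact (scale_large hE4 hr.two_le_ratio hr.baseScale_lt hjt hj).2.1.trans hDn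
  have hJc : (topSet x h).card = h := card_topSet x (hhm.le.trans hmn)
  have hJc' : (topSet x m).card = m := card_topSet x hmn
  have hJ : topSet x h ⊆ topSet x m := topSet_mono x hhm.le
  have hxa : ∀ i ∈ topSet x h, a ≤ |x i| :=
    fun i hi => rearr_le_of_mem_topSet x (hhm.le.trans hmn) hi
  have hxτ : ∀ i ∉ topSet x m, |x i| ≤ τ := fun i hi => le_rearr_of_notMem_topSet x hi
  rcases le_or_gt j (t₀ n p) with hjt | hjt
  · obtain ⟨h1, h2, h3⟩ := scale_small (γ := 1000) hE4 hj1 hjt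
    exact large_rows_of_small_excess hJ hrow hclash
      (hex _ (by rw [hJc']; omega) (by rw [hJc']; exact h2)) (by rw [hJc, hJc']; exact h1)
      (by rw [hJc]; exact h3) hk hτ0 ha0 hxa hxτ hMτ hzero
  · obtain ⟨h1, h2, h3⟩ := scale_large hE4 hr.two_le_ratio hr.baseScale_lt hjt hj
    right
    refine many_large_of_singleRows hJ hrow hτ0 ha0 hxa hxτ hMτ (hblk _ _ hJ ?_ ?_ ?_)
    · rw [hJc]; exact h3
    · rw [hJc, hJc']; exact h1
    · rw [hJc']; exact h2

/-! ### Asymptotics -/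

/-- Statements about large `u = p n` hold for large `n`, uniformly in the admissible `p`, because
`p n` lies between `log n` and `2 log n`. -/
lemma eventually_forall_inRange {β : ℕ} (hβ : 1 ≤ β) {Q : ℕ → ℝ → Prop}
    (h : ∀ᶠ u : ℝ in atTop, ∀ n : ℕ, ∀ p : ℝ, 0 < n → p * n = u → Real.log n ≤ u →
      u ≤ 2 * Real.log n → Q n p) :
    ∀ᶠ n : ℕ in atTop, ∀ p : unitInterval, InRange β n p → Q n p := by
  obtain ⟨U, hU⟩ := eventually_atTop.1 h
  have hlog : Tendsto (fun n : ℕ => Real.log n) atTop atTop :=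
    Real.tendsto_log_atTop.comp tendsto_natCast_atTop_atTop
  filter_upwards [hlog.eventually_ge_atTop U, eventually_gt_atTop 0] with n hn hn0 p hp
  have hn0' : (0 : ℝ) < n := by exact_mod_cast hn0
  have hL0 : 0 ≤ Real.log n := Real.log_natCast_nonneg n
  have h1 : Real.log n ≤ p * n := (div_le_iff₀ hn0').1 hp.1
  have hβ' : (1 : ℝ) ≤ β := by exact_mod_cast hβ
  have h2 : (p : ℝ) * n ≤ 2 * Real.log n := by
    have h3 : 1 / (2 * (β : ℝ)) ≤ 1 := by
      rw [div_le_one (by positivity)]; linarith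
    calc (p : ℝ) * n ≤ ((1 + 1 / (2 * (β : ℝ))) * (Real.log n / n)) * n := by
          gcongr
          exact hp.2
      _ = (1 + 1 / (2 * (β : ℝ))) * Real.log n := by field_simp
      _ ≤ _ := by gcongr; linarith
  exact hU _ (hn.trans h1) n p hn0 rfl h1 h2

lemma eventually_exp_neg_sqrt_le :
    ∀ᶠ l : ℝ in atTop, Real.exp (-(√l / 8)) ≤ 1 / (8 * l ^ 2) := by
  have h1 := Real.tendsto_pow_mul_exp_neg_atTop_nhds_zero 4
  have h2 : Tendsto (fun l : ℝ => √l / 8) atTop atTop :=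
    Real.tendsto_sqrt_atTop.atTop_div_const (by norm_num)
  filter_upwards [(h1.comp h2).eventually_le_const (show (0 : ℝ) < 1 / 32768 by norm_num),
    eventually_gt_atTop 0] with l hl hl0
  simp only [Function.comp] at hl
  have h3 : (√l / 8) ^ 4 = l ^ 2 / 4096 := by
    have : √l ^ 4 = l ^ 2 := by
      calc √l ^ 4 = (√l ^ 2) ^ 2 := by ring
        _ = l ^ 2 := by rw [Real.sq_sqrt hl0.le]
    rw [div_pow, this]; norm_num
  rw [h3] at hl
  rw [le_div_iff₀ (by positivity)]
  linarith

lemma eventually_regular {k : ℕ} (hk : 5 ≤ k) :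
    ∀ᶠ u : ℝ in atTop, ∀ n : ℕ, ∀ p : ℝ, 0 < n → p * n = u → Real.log n ≤ u →
      u ≤ 2 * Real.log n → Regular k n p := by
  have hpow : ∀ᶠ u : ℝ in atTop, Real.log u ^ 4 ≤ u := by
    have := (Real.isLittleO_pow_log_id_atTop (n := 4)).bound (show (0 : ℝ) < 1 by norm_num)
    filter_upwards [this, eventually_ge_atTop 0] with u h hu
    simp only [Real.norm_eq_abs, id, one_mul, abs_of_nonneg hu] at h
    exact (le_abs_self _).trans h
  filter_upwards [Real.tendsto_log_atTop.eventually_ge_atTop 400, hpow,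
    Real.tendsto_log_atTop.eventually eventually_exp_neg_sqrt_le, eventually_ge_atTop (k : ℝ),
    eventually_ge_atTop ((2 : ℝ) ^ (5 * k) * 100), eventually_ge_atTop 1]
    with u hl hl4 hexp huk hu2 hu1 n p hn hpn hLu huL
  subst hpn
  have hn0 : (0 : ℝ) < n := by exact_mod_cast hn
  set u := p * n with hu
  set l := Real.log u with hldef
  set L := Real.log n with hL
  have hu0 : 0 < u := by linarith
  have hl0 : 0 < l := by linarith
  have hp0 : 0 < p := by
    by_contra h
    have : u ≤ 0 := mul_nonpos_of_nonpos_of_nonneg (not_lt.1 h) hn0.le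
    linarith
  have huexp : Real.exp l = u := Real.exp_log hu0
  have hl2 : l ^ 2 * l ^ 2 ≤ u := by
    calc l ^ 2 * l ^ 2 = l ^ 4 := by ring
      _ ≤ u := hl4
  have hl400 : 400 * l ≤ l ^ 2 := by rw [sq]; gcongr
  have hdiv : l ^ 2 ≤ u / l ^ 2 := by rwa [le_div_iff₀ (by positivity)]
  have hdiv2 : u / l ^ 2 ≤ u / 100 := by
    gcongr; linarith
  have hul : 400 * l ≤ u := by
    have : l ^ 2 * 1 ≤ l ^ 2 * l ^ 2 := by gcongr; linarith
    linarith
  -- two-sided bounds for the scale `E`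
  have hElow : Real.exp (u / l ^ 2) ≤ baseScale n p := Nat.le_ceil _
  have hEup : (baseScale n p : ℝ) ≤ Real.exp (1 + u / l ^ 2) := baseScale_le_exp hu0.le
  have hE4u : 4 * u ≤ baseScale n p := by
    refine le_trans ?_ hElow
    calc 4 * u ≤ Real.exp 3 * Real.exp l := by
          rw [huexp]
          have := Real.add_one_le_exp (3 : ℝ)
          gcongr
          linarith
      _ = Real.exp (3 + l) := by rw [Real.exp_add]
      _ ≤ _ := by
          gcongr
          linarith
  have hsmall : Real.exp 2 * (baseScale n p : ℝ) ^ 7 * u ^ 6 ≤ n := by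
    calc Real.exp 2 * (baseScale n p : ℝ) ^ 7 * u ^ 6 ≤
          Real.exp 2 * Real.exp (1 + u / l ^ 2) ^ 7 * Real.exp l ^ 6 := by
          rw [huexp]; gcongr
      _ = Real.exp (2 + 7 * (1 + u / l ^ 2) + 6 * l) := by
          rw [← Real.exp_nat_mul, ← Real.exp_nat_mul, ← Real.exp_add, ← Real.exp_add]
          norm_num
      _ ≤ Real.exp L := by
          gcongr
          linarith
      _ = n := Real.exp_log hn0
  have hEu : (baseScale n p : ℝ) * (1000 * u) < n := by
    refine lt_of_lt_of_le ?_ hsmall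
    have hE4 : (4 : ℝ) ≤ baseScale n p := by linarith
    have h2 : (1000 : ℝ) < Real.exp 2 * (baseScale n p : ℝ) ^ 6 := by
      calc (1000 : ℝ) < 1 * 4 ^ 6 := by norm_num
        _ ≤ _ := by
            gcongr
            exact Real.one_le_exp (by norm_num)
    have h3 : u ≤ u ^ 6 := le_self_pow₀ hu1 (by norm_num)
    calc (baseScale n p : ℝ) * (1000 * u) = 1000 * (baseScale n p * u) := by ring
      _ < Real.exp 2 * (baseScale n p : ℝ) ^ 6 * (baseScale n p * u) := by gcongr
      _ ≤ Real.exp 2 * (baseScale n p : ℝ) ^ 6 * (baseScale n p * u ^ 6) := by gcongr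
      _ = _ := by ring
  have hE1 : (1 : ℝ) ≤ baseScale n p := by linarith
  refine ⟨hn, hp0, ?_, hLu, huL, hl, hl4, hexp, hE4u, ?_, hsmall, ?_, ?_⟩
  · rw [le_div_iff₀ (by norm_num)]
    have h1 : 1 * (1000 * u) ≤ baseScale n p * (1000 * u) := by gcongr
    have h2 : p * 1000 * n ≤ 1 * n := by
      have : p * 1000 * n = 1000 * u := by rw [hu]; ring
      linarith
    exact le_of_mul_le_mul_right h2 hn0
  · have : (k : ℝ) ≤ baseScale n p := by linarith
    exact_mod_cast this
  · have h1 : (baseScale n p : ℝ) < 1 / (1000 * p) := by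
      rw [lt_div_iff₀ (by positivity)]
      have h2 : (baseScale n p * (1000 * p)) * n < 1 * n := by
        have : (baseScale n p * (1000 * p)) * n = baseScale n p * (1000 * u) := by
          rw [hu]; ring
        linarith
      exact lt_of_mul_lt_mul_right h2 hn0.le
    have h3 := h1.trans_le (Nat.le_ceil (1 / (1000 * p)))
    exact_mod_cast h3
  · have h1 : (u / 2) ^ (5 * k) ≤ L ^ (5 * k) := by
      gcongr
      linarith
    refine le_trans ?_ h1
    rw [div_pow, le_div_iff₀ (by positivity)]
    have h2 : 2 * Real.exp 3 ≤ 96 := by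
      have h3 : Real.exp 3 = Real.exp 1 ^ 3 := by rw [← Real.exp_nat_mul]; norm_num
      have h4 : Real.exp 1 ^ 3 ≤ 3 ^ 3 := by
        have := Real.exp_one_lt_d9
        gcongr
        linarith
      rw [h3]; linarith
    have h5 : 1 ≤ u ^ (2 * k + 4) := one_le_pow₀ hu1
    calc (4 + 2 * Real.exp 3 * u ^ (2 * k + 4)) * 2 ^ (5 * k) ≤
          (100 * u ^ (2 * k + 4)) * 2 ^ (5 * k) := by
          gcongr
          nlinarith
      _ = u ^ (2 * k + 4) * (2 ^ (5 * k) * 100) := by ring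
      _ ≤ u ^ (2 * k + 4) * u := by gcongr
      _ = u ^ (2 * k + 5) := by rw [pow_succ u (2 * k + 4)]
      _ ≤ u ^ (5 * k) := pow_le_pow_right₀ hu1 (by omega)

/-- The number of scales is at most about `log n / log log n`. -/
lemma numScales_le {k n : ℕ} {p : ℝ} (hr : Regular k n p)
    (hpos : 0 < Real.log (p * n) - 3 * Real.log (Real.log (p * n))) :
    (numScales n p 1000 : ℝ) ≤ 3 + p * n / Real.log (p * n) ^ 2 +
      Real.log n / (Real.log (p * n) - 3 * Real.log (Real.log (p * n))) := by
  have hn0 : (0 : ℝ) < n := by exact_mod_cast hr.n_pos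
  have hl := hr.log_ge
  have hu := hr.four_hundred_le
  set u := p * n with hudef
  set l := Real.log u with hldef
  have hl0 : 0 < l := by linarith
  have hu0 : 0 < u := by linarith
  obtain ⟨ht1, ht2, -⟩ := t₀_spec hr.four_le_baseScale
  obtain ⟨hs1, hs2, -⟩ := t₁_spec (γ := 1000) hr.four_le_baseScale hr.two_le_ratio hr.baseScale_lt
  have hE4 : (4 : ℝ) ≤ baseScale n p := by exact_mod_cast hr.four_le_baseScale
  have hEup : Real.log (baseScale n p) ≤ 1 + u / l ^ 2 := by
    rw [Real.log_le_iff_le_exp (by linarith)]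
    exact baseScale_le_exp hu0.le
  have ht : (t₀ n p : ℝ) ≤ 2 + u / l ^ 2 := by
    have h1 : ((t₀ n p - 1 : ℕ) : ℝ) * Real.log 3 ≤ Real.log (baseScale n p) := by
      rw [← Real.log_pow]
      refine Real.log_le_log (by positivity) ?_
      exact_mod_cast ht2.le
    have h2 : 1 ≤ Real.log 3 := by
      rw [Real.le_log_iff_exp_le (by norm_num)]
      have := Real.exp_one_lt_d9; linarith
    have h3 : ((t₀ n p - 1 : ℕ) : ℝ) * 1 ≤ ((t₀ n p - 1 : ℕ) : ℝ) * Real.log 3 := by gcongr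
    have h4 : ((t₀ n p - 1 : ℕ) : ℝ) = t₀ n p - 1 := by push_cast [Nat.cast_sub ht1]; ring
    linarith
  have hs : (t₁ n p 1000 : ℝ) ≤ 1 + Real.log n / (l - 3 * Real.log l) := by
    have hlogR : Real.log (ratio n p) = l - 3 * Real.log l := by
      rw [ratio, ← hudef, ← hldef, Real.log_div hu0.ne' (by positivity), Real.log_pow, ← hldef]
      norm_num
    have hR0 : 0 < ratio n p := by linarith [hr.two_le_ratio]
    have h1 : ratio n p ^ (t₁ n p 1000 - 1) ≤ n := by
      have hD : (topScale p 1000 : ℝ) ≤ n := by exact_mod_cast hr.topScale_le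
      calc ratio n p ^ (t₁ n p 1000 - 1) ≤ baseScale n p * ratio n p ^ (t₁ n p 1000 - 1) :=
            le_mul_of_one_le_left (by positivity) (by linarith)
        _ ≤ n := hs2.le.trans hD
    have h2 : ((t₁ n p 1000 - 1 : ℕ) : ℝ) * (l - 3 * Real.log l) ≤ Real.log n := by
      rw [← hlogR, ← Real.log_pow]
      exact Real.log_le_log (by positivity) h1
    have h4 : ((t₁ n p 1000 - 1 : ℕ) : ℝ) = t₁ n p 1000 - 1 := by
      push_cast [Nat.cast_sub hs1]; ring
    rw [← le_div_iff₀ hpos, h4] at h2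
    linarith
  have : (numScales n p 1000 : ℝ) = t₀ n p + t₁ n p 1000 := by
    rw [numScales]; push_cast; ring
  linarith

/-- The factor of `norm_sq_le_of_mem_steepLevel` is `n ^ (2 + o(1))`. -/
lemma eventually_norm_factor_le {δ : ℝ} (hδ : 0 < δ) :
    ∀ᶠ u : ℝ in atTop, ∀ n : ℕ, ∀ p : ℝ, 0 < n → p * n = u → Real.log n ≤ u →
      u ≤ 2 * Real.log n →
      n + baseScale n p * (1000 * (p * n)) ^ (2 * numScales n p 1000) * (1 + Real.log n) ≤
        ((n : ℝ) ^ (1 + δ) / 100) ^ 2 := by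
  have hll : ∀ᶠ l : ℝ in atTop, 7 + 3 * (1 + δ / 2) * Real.log l ≤ δ / 2 * l := by
    have h1 := Real.isLittleO_log_id_atTop.bound
      (show (0 : ℝ) < (δ / 4) / (3 * (1 + δ / 2)) by positivity)
    filter_upwards [h1, eventually_ge_atTop (28 / δ), eventually_gt_atTop 0] with l h2 h3 h4
    simp only [Real.norm_eq_abs, id, abs_of_pos h4] at h2
    have h5 := (le_abs_self _).trans h2
    have h6 : 3 * (1 + δ / 2) * Real.log l ≤ 3 * (1 + δ / 2) * (δ / 4 / (3 * (1 + δ / 2)) * l) := by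
      gcongr
    have h7 : 3 * (1 + δ / 2) * (δ / 4 / (3 * (1 + δ / 2)) * l) = δ / 4 * l := by field_simp
    rw [div_le_iff₀ hδ] at h3
    linarith
  filter_upwards [eventually_regular (k := 5) le_rfl, Real.tendsto_log_atTop.eventually hll,
    Real.tendsto_log_atTop.eventually_ge_atTop (38 / δ)] with u hreg hll hlδ n p hn hpn hLu huL
  have hr := hreg n p hn hpn hLu huL
  have hl := hr.log_ge
  have hl4 := hr.log_pow_le
  have hns := numScales_le hr
  subst hpn
  have hn0 : (0 : ℝ) < n := by exact_mod_cast hn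
  set u := p * n with hu
  set l := Real.log u with hldef
  set L := Real.log n with hL
  set s := numScales n p 1000 with hs
  have hl0 : 0 < l := by linarith
  have hu0 : 0 < u := by linarith [hr.four_hundred_le]
  have huexp : Real.exp l = u := Real.exp_log hu0
  have hnexp : Real.exp L = n := Real.exp_log hn0
  have hlog0 : 0 ≤ Real.log l := Real.log_nonneg (by linarith)
  -- the exponent of the factor that comes from the large scales
  have hgap : l + 7 ≤ (1 + δ / 2) * (l - 3 * Real.log l) := by linarith
  have hpos : 0 < l - 3 * Real.log l := by
    by_contra h
    have : (1 + δ / 2) * (l - 3 * Real.log l) ≤ 0 :=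
      mul_nonpos_of_nonneg_of_nonpos (by positivity) (not_lt.1 h)
    linarith
  have hs' := hns hpos
  have hL0 : 0 ≤ L := by linarith
  have hfrac : L / (l - 3 * Real.log l) * (l + 7) ≤ L * (1 + δ / 2) := by
    calc L / (l - 3 * Real.log l) * (l + 7) ≤
          L / (l - 3 * Real.log l) * ((1 + δ / 2) * (l - 3 * Real.log l)) := by gcongr
      _ = _ := by field_simp
  have hul : l ≤ u / l := by
    rw [le_div_iff₀ hl0]
    have h1 : l * l ≤ l ^ 4 := by
      rw [← sq]
      exact pow_le_pow_right₀ (by linarith) (by norm_num)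
    linarith
  have hul2 : u / l ^ 2 ≤ u / l := by
    gcongr
    exact le_self_pow₀ (by linarith) (by norm_num)
  have hδu : 19 * (u / l) ≤ δ * L := by
    have h1 : 38 ≤ l * δ := (div_le_iff₀ hδ).1 hlδ
    have h2 : 19 * (u / l) ≤ (l * δ / 2) * (u / l) := by gcongr; linarith
    have h3 : (l * δ / 2) * (u / l) = δ * (u / 2) := by field_simp
    have h4 : δ * (u / 2) ≤ δ * L := by gcongr; linarith
    linarith
  have hslog : s * (l + 7) ≤ (3 + u / l ^ 2) * (2 * l) + L * (1 + δ / 2) := by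
    calc s * (l + 7) ≤ (3 + u / l ^ 2 + L / (l - 3 * Real.log l)) * (l + 7) := by gcongr
      _ = (3 + u / l ^ 2) * (l + 7) + L / (l - 3 * Real.log l) * (l + 7) := by ring
      _ ≤ _ := by
          gcongr
          linarith
  have hmid : (3 + u / l ^ 2) * (2 * l) = 6 * l + 2 * (u / l) := by field_simp; ring
  have h20000 : (20000 : ℝ) ≤ Real.exp 10 := by
    have h1 := Real.exp_one_gt_d9
    have h2 : Real.exp 10 = Real.exp 1 ^ 10 := by rw [← Real.exp_nat_mul]; norm_num
    rw [h2]
    calc (20000 : ℝ) ≤ 2.7182818283 ^ 10 := by norm_num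
      _ ≤ _ := by gcongr
  have hEup : (baseScale n p : ℝ) ≤ Real.exp (1 + u / l ^ 2) := baseScale_le_exp hu0.le
  have hWup : 1000 * u ≤ Real.exp (l + 7) := by
    rw [add_comm l, Real.exp_add, huexp]
    gcongr
    have h1 := Real.exp_one_gt_d9
    have h2 : Real.exp 7 = Real.exp 1 ^ 7 := by rw [← Real.exp_nat_mul]; norm_num
    rw [h2]
    calc (1000 : ℝ) ≤ 2.7182818283 ^ 7 := by norm_num
      _ ≤ _ := by gcongr
  have hLup : 1 + L ≤ Real.exp (1 + l) := by
    rw [Real.exp_add, huexp]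
    have h3 : 2 ≤ Real.exp 1 := by
      have := Real.exp_one_gt_d9; linarith
    have : 1 ≤ u := by linarith [hr.four_hundred_le]
    nlinarith
  have hsq : ((n : ℝ) ^ (1 + δ) / 100) ^ 2 = Real.exp ((2 + 2 * δ) * L) / 10000 := by
    rw [div_pow, ← hnexp, ← Real.exp_mul, ← Real.exp_nat_mul]
    norm_num
    ring_nf
  have hA : 20000 * (n : ℝ) ≤ Real.exp ((2 + 2 * δ) * L) := by
    calc 20000 * (n : ℝ) ≤ Real.exp 10 * Real.exp L := by rw [hnexp]; gcongr
      _ = Real.exp (10 + L) := by rw [Real.exp_add]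
      _ ≤ _ := by
          gcongr
          have : 0 ≤ δ * L := by positivity
          have := hr.four_hundred_le
          linarith
  have hB : 20000 * (baseScale n p * (1000 * u) ^ (2 * s) * (1 + L)) ≤
      Real.exp ((2 + 2 * δ) * L) := by
    calc 20000 * (baseScale n p * (1000 * u) ^ (2 * s) * (1 + L)) ≤
          Real.exp 10 * (Real.exp (1 + u / l ^ 2) * Real.exp (l + 7) ^ (2 * s) *
            Real.exp (1 + l)) := by gcongr
      _ = Real.exp (10 + ((1 + u / l ^ 2) + 2 * (s * (l + 7)) + (1 + l))) := by
          rw [← Real.exp_nat_mul, ← Real.exp_add, ← Real.exp_add, ← Real.exp_add]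
          push_cast
          ring_nf
      _ ≤ _ := by
          gcongr
          linarith
  rw [hsq]
  linarith

/-- Diagonalisation: a property that holds eventually for each fixed `δ > 0` holds eventually along
some sequence tending to zero. -/
lemma exists_tendsto_zero_of_eventually {P : ℕ → ℝ → Prop}
    (h : ∀ δ : ℝ, 0 < δ → ∀ᶠ n in atTop, P n δ) :
    ∃ d : ℕ → ℝ, Tendsto d atTop (𝓝 0) ∧ ∀ᶠ n in atTop, P n (d n) := by
  classical
  have hN : ∀ m : ℕ, ∃ N : ℕ, ∀ n ≥ N, P n (1 / ((m : ℝ) + 1)) := fun m =>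
    eventually_atTop.1 (h _ (by positivity))
  choose N hN using hN
  set g : ℕ → ℕ := fun n => Nat.findGreatest (fun m => N m ≤ n) n with hg
  have hgt : Tendsto g atTop atTop := by
    refine tendsto_atTop.2 fun m => ?_
    filter_upwards [eventually_ge_atTop (max (N m) m)] with n hn
    exact Nat.le_findGreatest ((le_max_right _ _).trans hn) ((le_max_left _ _).trans hn)
  refine ⟨fun n => 1 / ((g n : ℝ) + 1), tendsto_one_div_add_atTop_nhds_zero_nat.comp hgt, ?_⟩
  filter_upwards [eventually_ge_atTop (N 0)] with n hn
  exact hN (g n) n (Nat.findGreatest_spec (P := fun m => N m ≤ n) (Nat.zero_le n) hn)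

lemma exp_le_one_sub {z : ℝ} (hz : z < 1) : Real.exp (-(z / (1 - z))) ≤ 1 - z := by
  have h0 : 0 < 1 - z := by linarith
  rw [Real.exp_neg]
  refine inv_le_of_inv_le₀ h0 ?_
  have h1 := Real.add_one_le_exp (z / (1 - z))
  have h2 : z / (1 - z) + 1 = (1 - z)⁻¹ := by field_simp; ring
  linarith

/-- The probability of at least `β` zero columns is at least of order `n ^ (-1 / 2)`. -/
lemma exp_le_law_compl_fewZeroColumns {β k n : ℕ} (hβ : 1 ≤ β) {p : unitInterval}
    (hr : Regular k n p) (hp : InRange β n p) (hn : 2 * β ≤ n) :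
    Real.exp (-(β + 2)) / (2 ^ β * (β.factorial : ℝ)) * Real.exp (-(Real.log n / 2)) ≤
      (law n p).real (fewZeroColumns n β)ᶜ := by
  refine le_trans ?_ (le_law_compl_fewZeroColumns n β p)
  have hn0 : (0 : ℝ) < n := by exact_mod_cast hr.n_pos
  have hn2 : (2 : ℝ) ≤ n := by exact_mod_cast (by omega : 2 ≤ n)
  have hβ0 : (1 : ℝ) ≤ β := by exact_mod_cast hβ
  have hp0 := hr.p_pos
  have hp1 := hr.p_le
  set u := (p : ℝ) * n with hu
  set q : ℝ := (1 - (p : ℝ)) ^ n with hq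
  have hq0 : 0 ≤ q := pow_nonneg (by linarith) n
  have hchoose : ((n : ℝ) / 2) ^ β / β.factorial ≤ n.choose β := by
    refine le_trans ?_ (Nat.pow_le_choose β n)
    gcongr
    rw [div_le_iff₀ (by norm_num)]
    exact_mod_cast (by omega : n ≤ (n + 1 - β) * 2)
  have hqlow : Real.exp (-(u + 1)) ≤ q := by
    have h1 := exp_le_one_sub (z := (p : ℝ)) (by linarith)
    calc Real.exp (-(u + 1)) ≤ Real.exp (-((p : ℝ) / (1 - p))) ^ n := by
          rw [← Real.exp_nat_mul]
          gcongr
          -- `n p² ≤ 1 / 2` as `p` is of order `log n / n`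
          have h2 : u * p ≤ 1 / 2 := by
            have h3 := hr.baseScale_small
            have h4 := hr.four_hundred_le
            have hE4 : (4 : ℝ) ≤ baseScale n p := by exact_mod_cast hr.four_le_baseScale
            have h5 : 2 * u ^ 2 ≤ n := by
              refine le_trans ?_ h3
              have h6 : u ^ 2 ≤ u ^ 6 := pow_le_pow_right₀ (by linarith) (by norm_num)
              have h7 : (2 : ℝ) ≤ Real.exp 2 * (baseScale n p : ℝ) ^ 7 := by
                calc (2 : ℝ) ≤ 1 * 4 ^ 7 := by norm_num
                  _ ≤ _ := by
                    gcongr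
                    exact Real.one_le_exp (by norm_num)
              calc 2 * u ^ 2 ≤ 2 * u ^ 6 := by gcongr
                _ ≤ _ := by gcongr
            have h8 : (u * p) * n ≤ 1 / 2 * n := by
              have : (u * p) * n = u ^ 2 := by rw [hu]; ring
              linarith
            exact le_of_mul_le_mul_right h8 hn0
          have h3 : (p : ℝ) / (1 - p) ≤ p + 2 * (p * p) := by
            rw [div_le_iff₀ (by linarith)]
            nlinarith
          have h4 : n * ((p : ℝ) / (1 - p)) ≤ n * (p + 2 * (p * p)) := by gcongr
          have h5 : n * ((p : ℝ) + 2 * (p * p)) = u + 2 * (u * p) := by rw [hu]; ring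
          linarith
      _ ≤ q := by rw [hq]; gcongr
  have hqup : q ≤ (n : ℝ)⁻¹ := by
    refine le_trans ?_ hr.exp_neg_le
    have : -((p : ℝ) * n) = n * (-(p : ℝ)) := by ring
    rw [this, Real.exp_nat_mul, hq]
    have h1 := Real.add_one_le_exp (-(p : ℝ))
    have h2 := p.2.2
    gcongr
    linarith
  have hninv : (n : ℝ)⁻¹ ≤ 1 / 2 := by rw [one_div]; gcongr
  have hrest : Real.exp (-2) ≤ (1 - q) ^ (n - β) := by
    have h1 := exp_le_one_sub (z := (n : ℝ)⁻¹) (by linarith)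
    have h2 : (n : ℝ)⁻¹ / (1 - (n : ℝ)⁻¹) ≤ 2 * (n : ℝ)⁻¹ := by
      rw [div_le_iff₀ (by linarith)]
      have : 0 ≤ (n : ℝ)⁻¹ := by positivity
      nlinarith
    calc Real.exp (-2) = Real.exp (-(2 * (n : ℝ)⁻¹)) ^ n := by
          rw [← Real.exp_nat_mul]; congr 1; field_simp
      _ ≤ (1 - (n : ℝ)⁻¹) ^ n := by
          gcongr
          refine le_trans ?_ h1
          gcongr
      _ ≤ (1 - (n : ℝ)⁻¹) ^ (n - β) := by
          refine pow_le_pow_of_le_one (by linarith) ?_ (Nat.sub_le _ _)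
          have : 0 ≤ (n : ℝ)⁻¹ := by positivity
          linarith
      _ ≤ _ := by gcongr; linarith
  have hβu : β * u ≤ (β + 1 / 2) * Real.log n := by
    have h1 : u ≤ (1 + 1 / (2 * (β : ℝ))) * Real.log n := by
      calc u ≤ ((1 + 1 / (2 * (β : ℝ))) * (Real.log n / n)) * n := by
            rw [hu]; gcongr; exact hp.2
        _ = _ := by field_simp
    calc β * u ≤ β * ((1 + 1 / (2 * (β : ℝ))) * Real.log n) := by gcongr
      _ = _ := by field_simp
  calc Real.exp (-(β + 2)) / (2 ^ β * (β.factorial : ℝ)) * Real.exp (-(Real.log n / 2))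
      = Real.exp (β * Real.log n) / 2 ^ β / β.factorial *
          Real.exp (-(β + 2) - Real.log n / 2 - β * Real.log n) := by
        rw [Real.exp_sub, Real.exp_sub, Real.exp_neg (Real.log n / 2)]
        field_simp
    _ ≤ Real.exp (β * Real.log n) / 2 ^ β / β.factorial *
          Real.exp (β * (-(u + 1)) + (-2)) := by
        gcongr
        linarith
    _ = ((n : ℝ) / 2) ^ β / β.factorial * (Real.exp (-(u + 1)) ^ β * Real.exp (-2)) := by
        rw [Real.exp_add, Real.exp_nat_mul, Real.exp_nat_mul, Real.exp_log hn0, div_pow]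
    _ ≤ _ := by gcongr

lemma eventually_log_pow_le (k : ℕ) {c : ℝ} (hc : 0 < c) :
    ∀ᶠ n : ℕ in atTop, Real.log n ^ k * (n : ℝ)⁻¹ ≤ c * Real.exp (-(Real.log n / 2)) := by
  have hlog : Tendsto (fun n : ℕ => Real.log n / 2) atTop atTop :=
    (Real.tendsto_log_atTop.comp tendsto_natCast_atTop_atTop).atTop_div_const (by norm_num)
  have h1 := (Real.tendsto_pow_mul_exp_neg_atTop_nhds_zero k).comp hlog
  filter_upwards [h1.eventually_le_const (show (0 : ℝ) < c / 2 ^ k by positivity),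
    eventually_gt_atTop 0] with n hn hn0
  have hn0' : (0 : ℝ) < n := by exact_mod_cast hn0
  simp only [Function.comp, div_pow] at hn
  have h2 : Real.log n ^ k * Real.exp (-(Real.log n / 2)) ≤ c := by
    rw [div_mul_eq_mul_div, div_le_div_iff_of_pos_right (by positivity)] at hn
    exact hn
  have h3 : (n : ℝ)⁻¹ = Real.exp (-(Real.log n / 2)) * Real.exp (-(Real.log n / 2)) := by
    rw [← Real.exp_add, ← neg_add, add_halves, Real.exp_neg, Real.exp_log hn0']
  rw [h3, ← mul_assoc]
  gcongr

end BernoulliRank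

theorem mainTheorem6 (β : ℕ) (hβ : 1 ≤ β) :
    ∃ CT γ C : ℝ, 1 ≤ CT ∧ 1 ≤ γ ∧ 1 ≤ C ∧ ∀ k : ℕ, C ≤ (k : ℝ) →
      -- the probability bound is `o(P(Ω₀ᶜ))`, uniformly in the admissible `p`
      (∀ δ : ℝ, 0 < δ → ∀ᶠ n : ℕ in atTop, ∀ p : unitInterval, BernoulliRank.InRange β n p →
        Real.log n ^ (5 * k) * (n : ℝ)⁻¹ ≤
          δ * (BernoulliRank.law n p).real (BernoulliRank.fewZeroColumns n β)ᶜ) ∧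
      -- `ε n` is the `o(1)` of the two exponents
      ∃ ε : ℕ → ℝ, Tendsto ε atTop (𝓝 0) ∧
        ∀ᶠ n : ℕ in atTop, ∀ p : unitInterval, BernoulliRank.InRange β n p →
          ∃ E : Set (BernoulliRank.Sample n), MeasurableSet E ∧
            (BernoulliRank.law n p).real Eᶜ ≤ Real.log n ^ (5 * k) * (n : ℝ)⁻¹ ∧
            ∀ ω ∈ E, ∀ x ∈ BernoulliRank.steep n p γ CT,
              (∀ j ∈ BernoulliRank.lowColumns (BernoulliRank.toMatrix ω) 0, x j = 0) →
              (n : ℝ) ^ (-1 + ε n) * ‖x‖ ≤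
                  ‖WithLp.toLp 2 (((BernoulliRank.toMatrix ω).submatrix
                    (Subtype.val : BernoulliRank.lowRows (BernoulliRank.toMatrix ω) k → Fin n)
                    id).mulVec x.ofLp)‖ ∨
                (k : ℝ) / 8 <
                  ((Finset.univ.filter fun i : Fin n =>
                    (n : ℝ) ^ (-1 + ε n) * ‖x‖ ≤
                      |(BernoulliRank.toMatrix ω).mulVec x.ofLp i|).card : ℝ) := by
  -- all three constants are generous, and none of them depends on `β`
  refine ⟨1000, 1000, 1000, by norm_num, by norm_num, by norm_num, fun k hk => ?_⟩
  have hk' : 1000 ≤ k := by exact_mod_cast hk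
  have hreg := BernoulliRank.eventually_forall_inRange hβ
    (BernoulliRank.eventually_regular (k := k) (by omega))
  constructor
  · intro δ hδ
    filter_upwards [hreg, eventually_ge_atTop (2 * β),
      BernoulliRank.eventually_log_pow_le (5 * k)
        (show 0 < δ * (Real.exp (-(β + 2)) / (2 ^ β * (β.factorial : ℝ))) by positivity)]
      with n hr hn hlog p hp
    refine hlog.trans ?_
    rw [mul_assoc]
    have := BernoulliRank.exp_le_law_compl_fewZeroColumns hβ (hr p hp) hp hn
    gcongr
  · obtain ⟨d, hd0, hd⟩ := BernoulliRank.exists_tendsto_zero_of_eventually fun δ hδ =>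
      BernoulliRank.eventually_forall_inRange hβ (BernoulliRank.eventually_norm_factor_le hδ)
    refine ⟨fun n => -d n, by simpa using hd0.neg, ?_⟩
    filter_upwards [hreg, hd] with n hr hd p hp
    have hrp := hr p hp
    have hn0 : (0 : ℝ) < n := by exact_mod_cast hrp.n_pos
    refine ⟨BernoulliRank.goodEvent n p 1000 k, (Set.toFinite _).measurableSet,
      BernoulliRank.law_compl_goodEvent_le hrp, fun ω hω x hx hzero => ?_⟩
    simp only [BernoulliRank.steep, Set.mem_iUnion, Finset.mem_Icc] at hx
    obtain ⟨j, ⟨hj1, hj⟩, hxj⟩ := hx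
    set a := BernoulliRank.rearr x (BernoulliRank.scale n p 1000 (j - 1)) with ha
    have ha0 : 0 ≤ a := BernoulliRank.rearr_nonneg _ _
    have hW : BernoulliRank.ratio n p ≤ 1000 * ((p : ℝ) * n) := by
      have h1 := hrp.log_ge
      have h2 := hrp.four_hundred_le
      have h3 : (1 : ℝ) ≤ Real.log (p * n) ^ 3 := one_le_pow₀ (by linarith)
      rw [BernoulliRank.ratio]
      exact (div_le_self (by linarith) h3).trans (by linarith)
    have hnorm := BernoulliRank.norm_sq_le_of_mem_steepLevel hxj hj1 hj hrp.four_le_baseScale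
      hrp.two_le_ratio hW
    have hnorm' : ‖x‖ ≤ a * ((n : ℝ) ^ (1 + d n) / 100) := by
      refine le_of_sq_le_sq ?_ (by positivity)
      rw [mul_pow]
      refine hnorm.trans ?_
      gcongr
      exact hd p hp
    have hbound : (n : ℝ) ^ (-1 + -d n) * ‖x‖ ≤ a / 100 := by
      calc (n : ℝ) ^ (-1 + -d n) * ‖x‖ ≤
            (n : ℝ) ^ (-1 + -d n) * (a * ((n : ℝ) ^ (1 + d n) / 100)) := by gcongr
        _ = ((n : ℝ) ^ (-1 + -d n) * (n : ℝ) ^ (1 + d n)) * (a / 100) := by ring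
        _ = a / 100 := by
            rw [← Real.rpow_add hn0]
            have : -1 + -d n + (1 + d n) = 0 := by ring
            rw [this, Real.rpow_zero, one_mul]
    rcases BernoulliRank.large_rows_of_goodEvent hrp hk' hω hj1 hj hxj hzero with ⟨i, hi, hai⟩ | hcard
    · exact Or.inl (hbound.trans (hai.trans (BernoulliRank.le_norm_of_mem_lowRows hi)))
    · right
      refine hcard.trans_le (Nat.cast_le.2 (Finset.card_le_card fun i hi => ?_))
      simp only [Finset.mem_filter_univ] at hi ⊢
      exact hbound.trans hi
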